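/- **Conventions.** A signature of arity $m$ is a function $\{0,1\}^m\to\mathbb{R}$; $[u,v]$ denotes the unary signature with values $u$ at $0$ and $v$ at $1$. For finite sets $\mathcal F$, $\mathcal G$ of signatures, an instance of $\operatorname{Holant}(\mathcal F\mid\mathcal G)$ is a signature grid: a finite bipartite multigraph whose left-hand side (LHS) vertices are labelled by signatures from $\mathcal F$ and whose right-hand side (RHS) vertices are labelled by signatures from $\mathcal G$, the edges at every vertex being matched in order with the variables of its label. The task is to compute $\sum_{\sigma:E\to\{0,1\}}\prod_{v}F_v(\sigma|_{E(v)})$, where $F_v$ is the label of $v$. A binary straddled signature with matrix $M\in\mathbb{R}^{2\times2}$ has one variable on the LHS (row index of $M$) and one variable on the RHS (column index); in a signature grid every edge joins an LHS variable to an RHS variable, where all variables of an LHS (RHS) vertex are on the LHS (RHS). All numbers are taken from a fixed finitely generated field $K=\mathbb{Q}(a_0,\dots,a_{r-1})\subset\mathbb{R}$ and are written as arithmetic formulas (with $+,-,\times$ and inversion) over $0,1,a_0,\dots,a_{r-1}$. $A\le_T B$ denotes polynomial-time Turing reducibility: a single oracle machine halts in polynomial time on every input, given any oracle for $B$ with answers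 of polynomially bounded length, and outputs a description of the value of every instance of $A$. A straddled signature with matrix $M$ *can be interpolated in* $\operatorname{Holant}(f\mid g)$ if the problem of computing the values of all signature grids that use $f$ on the LHS, $g$ on the RHS, and this straddled signature is $\le_T\operatorname{Holant}(f\mid g)$. **Lemma.** Let $f$ and $g$ be nonnegative valued signatures of arity $m$ and $n$, let $x,y\ge 0$, and let $x$, $y$ and all values of $f$ and $g$ lie in $K$. Suppose that the degenerate binary straddled signature with matrix $\begin{pmatrix}1&x\\y&xy\end{pmatrix}$ can be interpolated in $\operatorname{Holant}(f\mid g)$. 1. If $y>0$, or $g(0,\dots,0)\neq0$, or $g$ is a multiple of $[0,1]^{\otimes n}$ (possibly identically $0$), then $$\operatorname{Holant}(f\mid\{g,[1,x]\})\le_T\operatorname{Holant}(f\mid g).$$ 2. If $x>0$, or $f(0,\dots,0)\neq0$, or $f$ is a multiple of $[0,1]^{\otimes m}$ (possibly identically $0$), then $$\operatorname{Holant}(\{f,[1,y]\}\mid g)\le_T\operatorname{Holant}(f\mid g).$$ -/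

import Mathlib

namespace BipartiteHolant

/-! ### Signatures, signature grids and the Holant value -/

/-- A real-valued signature on the Boolean domain with `l` input variables on the LHS and `r` input
variables on the RHS. It is a straddled signature when both `l` and `r` are positive. -/
structure Sig where
  l : ℕ
  r : ℕ
  val : (Fin l → Bool) → (Fin r → Bool) → ℝ

/-- A signature of arity `m` placed on the LHS: all its variables are on the LHS. -/
def onLHS {m : ℕ} (f : (Fin m → Bool) → ℝ) : Sig := ⟨m, 0, fun α _ => f α⟩

/-- A signature of arity `n` placed on the RHS: all its variables are on the RHS. -/
def onRHS {n : ℕ} (g : (Fin n → Bool) → ℝ) : Sig := ⟨0, n, fun _ β => g β⟩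

/-- The unary signature `[u, v]`. -/
def unary (u v : ℝ) : (Fin 1 → Bool) → ℝ := fun b => if b 0 then v else u

/-- A Boolean value as a row or column index. -/
def bitIndex (b : Bool) : Fin 2 := if b then 1 else 0

/-- The binary straddled signature with signature matrix `M`: the row index is the input from the
LHS and the column index is the input from the RHS. -/
def straddled (M : Matrix (Fin 2) (Fin 2) ℝ) : Sig :=
  ⟨1, 1, fun p q => M (bitIndex (p 0)) (bitIndex (q 0))⟩

/-- A vertex of a signature grid over the signatures `S`: the label of the signature placed on it,
and the names of the edges attached to its LHS variables and to its RHS variables, in order. -/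
structure Vertex {k : ℕ} (S : Fin k → Sig) where
  label : Fin k
  left : Fin (S label).l → ℕ
  right : Fin (S label).r → ℕ

/-- The edges at the LHS variables of the vertices. -/
def leftEnds {k : ℕ} {S : Fin k → Sig} (V : List (Vertex S)) : List ℕ :=
  V.flatMap fun v => List.ofFn v.left

/-- The edges at the RHS variables of the vertices. -/
def rightEnds {k : ℕ} {S : Fin k → Sig} (V : List (Vertex S)) : List ℕ :=
  V.flatMap fun v => List.ofFn v.right

/-- A signature grid over the signatures `S`: every edge joins exactly one LHS variable to exactly
one RHS variable. If every signature of `S` has all its variables on one side, this is a bipartite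
(multi)graph whose vertices are labelled by signatures of the appropriate side. -/
structure Grid {k : ℕ} (S : Fin k → Sig) where
  vertices : List (Vertex S)
  nodup : (leftEnds vertices).Nodup
  perm : (leftEnds vertices).Perm (rightEnds vertices)

/-- The set of edges of a signature grid. -/
def Grid.edges {k : ℕ} {S : Fin k → Sig} (Ω : Grid S) : Finset ℕ := (leftEnds Ω.vertices).toFinset

/-- The Holant value: the sum over all 0-1 assignments of the edges of the product over all vertices
of the values of their signatures. The assignment is given by the set `T` of edges with value 1. -/
noncomputable def Grid.value {k : ℕ} {S : Fin k → Sig} (Ω : Grid S) : ℝ :=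
  ∑ T ∈ Ω.edges.powerset,
    (Ω.vertices.map fun v =>
      (S v.label).val (fun i => decide (v.left i ∈ T)) (fun j => decide (v.right j ∈ T))).prod

/-- A list of natural numbers as a bit string; every number `k` is written in unary as `1ᵏ0`. -/
def encodeNats (L : List ℕ) : List Bool := L.flatMap fun k => List.replicate k true ++ [false]

/-- A signature grid as a bit string: its vertices one after the other, every vertex as its label
followed by the edges at its LHS variables and the edges at its RHS variables. -/
def Grid.encode {k : ℕ} {S : Fin k → Sig} (Ω : Grid S) : List Bool :=
  encodeNats (Ω.vertices.flatMap fun v =>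
    (v.label : ℕ) :: (List.ofFn v.left ++ List.ofFn v.right))

/-! ### Counting problems with real values -/

/-- A computational problem: compute the real number `value I` from the bit string `encode I`. -/
structure Problem where
  Inst : Type
  encode : Inst → List Bool
  value : Inst → ℝ

/-- The Holant problem of the signatures `S`. -/
noncomputable def holant {k : ℕ} (S : Fin k → Sig) : Problem where
  Inst := Grid S
  encode := Grid.encode
  value := Grid.value

/-! ### Finite descriptions of real numbers

Numbers of the finitely generated field `ℚ(a₀, …, a_{r-1})` are written as arithmetic formulas over
the constants `0`, `1` and the generators. For fixed generators this is interchangeable in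
polynomial time with quotients of integer polynomials in the generators, with binary coefficients. -/

/-- Arithmetic formulas in `r` generators. -/
inductive Formula (r : ℕ) where
  | zero : Formula r
  | one : Formula r
  | gen (i : Fin r) : Formula r
  | add (e e' : Formula r) : Formula r
  | neg (e : Formula r) : Formula r
  | mul (e e' : Formula r) : Formula r
  | inv (e : Formula r) : Formula r

/-- `e.HasValue a v`: with the generators `a`, the formula `e` is defined (no division by zero
occurs in it) and its value is `v`. -/
inductive Formula.HasValue {r : ℕ} (a : Fin r → ℝ) : Formula r → ℝ → Prop
  | zero : HasValue a .zero 0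
  | one : HasValue a .one 1
  | gen (i : Fin r) : HasValue a (.gen i) (a i)
  | add {e e' : Formula r} {v v' : ℝ} :
      HasValue a e v → HasValue a e' v' → HasValue a (.add e e') (v + v')
  | neg {e : Formula r} {v : ℝ} : HasValue a e v → HasValue a (.neg e) (-v)
  | mul {e e' : Formula r} {v v' : ℝ} :
      HasValue a e v → HasValue a e' v' → HasValue a (.mul e e') (v * v')
  | inv {e : Formula r} {v : ℝ} : HasValue a e v → v ≠ 0 → HasValue a (.inv e) v⁻¹

/-- A formula in Polish (prefix) notation. -/
def Formula.tokens {r : ℕ} : Formula r → List ℕ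
  | .zero => [0]
  | .one => [1]
  | .add e e' => 2 :: (e.tokens ++ e'.tokens)
  | .neg e => 3 :: e.tokens
  | .mul e e' => 4 :: (e.tokens ++ e'.tokens)
  | .inv e => 5 :: e.tokens
  | .gen i => [6 + (i : ℕ)]

/-- The bit string `w` describes the real number `v` (in terms of the generators `a`). -/
def Describes {r : ℕ} (a : Fin r → ℝ) (w : List Bool) (v : ℝ) : Prop :=
  ∃ e : Formula r, encodeNats e.tokens = w ∧ e.HasValue a v

/-! ### Oracle machines with a step count

A machine is a structured program working on finitely many stacks of bits (two stacks make up one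
tape of a Turing machine), with access to an oracle. -/

/-- Programs; the stacks are numbered by natural numbers. -/
inductive Prog where
  /-- do nothing -/
  | skip : Prog
  /-- push the bit `b` on stack `i` -/
  | push (i : ℕ) (b : Bool) : Prog
  /-- remove the top bit of stack `i` (if there is one) -/
  | pop (i : ℕ) : Prog
  /-- replace the content of stack `i` by the answer of the oracle to it -/
  | query (i : ℕ) : Prog
  | seq (P Q : Prog) : Prog
  /-- if the top bit of stack `i` exists and is `b` then `P` else `Q` -/
  | branch (i : ℕ) (b : Bool) (P Q : Prog) : Prog
  /-- while the top bit of stack `i` exists and is `b` do `P` -/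
  | loop (i : ℕ) (b : Bool) (P : Prog) : Prog

/-- The contents of all stacks, the top bit first. -/
abbrev Store := ℕ → List Bool

/-- `Exec O P s s' t`: with the oracle `O`, the program `P` started with the stacks `s` halts with
the stacks `s'` after `t` steps. An oracle call takes one step, and one more for every bit of the
answer. -/
inductive Exec (O : List Bool → List Bool) : Prog → Store → Store → ℕ → Prop
  | skip (s : Store) : Exec O .skip s s 1
  | push (s : Store) (i : ℕ) (b : Bool) :
      Exec O (.push i b) s (Function.update s i (b :: s i)) 1
  | pop (s : Store) (i : ℕ) : Exec O (.pop i) s (Function.update s i (s i).tail) 1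
  | query (s : Store) (i : ℕ) :
      Exec O (.query i) s (Function.update s i (O (s i))) (1 + (O (s i)).length)
  | seq {P Q : Prog} {s s' s'' : Store} {t u : ℕ} :
      Exec O P s s' t → Exec O Q s' s'' u → Exec O (.seq P Q) s s'' (t + u)
  | branch_pos {i : ℕ} {b : Bool} {P Q : Prog} {s s' : Store} {t : ℕ} :
      (s i).head? = some b → Exec O P s s' t → Exec O (.branch i b P Q) s s' (t + 1)
  | branch_neg {i : ℕ} {b : Bool} {P Q : Prog} {s s' : Store} {t : ℕ} :
      (s i).head? ≠ some b → Exec O Q s s' t → Exec O (.branch i b P Q) s s' (t + 1)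
  | loop_done {i : ℕ} {b : Bool} {P : Prog} {s : Store} :
      (s i).head? ≠ some b → Exec O (.loop i b P) s s 1
  | loop_step {i : ℕ} {b : Bool} {P : Prog} {s s' s'' : Store} {t u : ℕ} :
      (s i).head? = some b → Exec O P s s' t → Exec O (.loop i b P) s' s'' u →
        Exec O (.loop i b P) s s'' (t + u + 1)

/-- The stacks at the start: the input on stack `0`, all other stacks empty. -/
def startStore (w : List Bool) : Store := fun i => if i = 0 then w else []

/-- `O` is an oracle for the problem `B`: it answers every instance of `B` with a description of its
value. Nothing is required of the answers to bit strings that are not instances. -/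
def Answers {r : ℕ} (a : Fin r → ℝ) (B : Problem) (O : List Bool → List Bool) : Prop :=
  ∀ I : B.Inst, Describes a (O (B.encode I)) (B.value I)

/-- Polynomial-time Turing reducibility `A ≤_T B`, for problems with values in the field generated
by `a`. There is one oracle program which, with every oracle for `B` that has polynomially bounded
answers, halts on every input within polynomially many steps, and on every instance of `A` leaves a
description of its value on stack `0`. -/
def TuringReducible {r : ℕ} (a : Fin r → ℝ) (A B : Problem) : Prop :=
  ∃ P : Prog, ∀ q : Polynomial ℕ, ∃ p : Polynomial ℕ, ∀ O : List Bool → List Bool,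
    Answers a B O → (∀ w, (O w).length ≤ q.eval w.length) →
      ∀ w : List Bool, ∃ (s : Store) (t : ℕ),
        Exec O P (startStore w) s t ∧ t ≤ p.eval w.length ∧
          ∀ I : A.Inst, A.encode I = w → Describes a (s 0) (A.value I)

/-- The binary straddled signature with matrix `M` can be interpolated in the problem
`Holant(f | g)`: the Holant values of all signature grids that use it besides `f` on the LHS and `g`
on the RHS can be computed in polynomial time with an oracle for `Holant(f | g)`. -/
def CanInterpolate {r : ℕ} (a : Fin r → ℝ) {m n : ℕ} (f : (Fin m → Bool) → ℝ)
    (g : (Fin n → Bool) → ℝ) (M : Matrix (Fin 2) (Fin 2) ℝ) : Prop :=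
  TuringReducible a (holant ![onLHS f, onRHS g, straddled M]) (holant ![onLHS f, onRHS g])

end BipartiteHolant

/-!
Let `w = [1, x]` be the unary signature to be realized on the RHS; the second claim is the first one
with the two sides exchanged, and both are treated at once by means of a Boolean parameter `flip`.

*Absorbing by `g`.* The straddled signature with matrix `[1, x; y, x * y]` is the product of `w` on
the RHS and `[1, y]` on the LHS. Hence in a grid every vertex with label `w` can be replaced by a
straddled one, at the price of a dangling edge that carries `[1, y]`. If the number of these edges is
divisible by the arity `n` of `g`, they are attached in groups of `n` to new vertices with label `g`.
Each new vertex multiplies the value by the contraction of `g` with `[1, y]^{⊗ n}`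
(`sumBits_splitGrid`), a constant which is positive if `y > 0` and `g` is not zero, or if
`g(0, …, 0) ≠ 0` (`contraction_ne_zero`), and which is divided out afterwards.

*Divisibility.* Counting the edges on both sides shows that the number of vertices with label `w` is
divisible by `n` as soon as the number of vertices with label `f` is
(`IsGrid.dvd_length_ends`). To reach this, the grid is joined with a disjoint gadget of nonzero value,
which depends only on the number of vertices with label `f` modulo `n` and is therefore part of the
program. If the value of the grid is not zero, such a gadget exists: `n - 1` copies of the grid itself
(`IsGrid.exists_complement`). So if there is no gadget for a residue class, all grids in this class
have the value zero. The value of the gadget is divided out, so no roots have to be taken.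

*Pinning by `g`.* In the remaining cases `g` vanishes outside `(1, …, 1)`. Then every edge at a vertex
with label `g` has the value one, and the Holant value is a product of one factor for every vertex,
where the factor of a vertex with label `f` depends only on which of its edges lead to a `w`
(`gridValue_of_pinning`). It is computed without the oracle.

*Machines.* The transformations of the encoded grids are performed by finite automata which read
their input once and write on auxiliary stacks; every such automaton is a polynomial-time program
(`Automaton.computes`). They are described by their reaction to the parts of a vertex (`Parser`):
`doubling` appends the gadget, `splitting` introduces the straddled vertices and the new vertices with
label `g`, and `marking` and `collecting` compute the product in the case of pinning. A formula in
Polish notation is multiplied by a constant by putting a fixed prefix in front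
(`exists_mul_prefix`), so no arithmetic is required.
-/

namespace BipartiteHolant

/-! ### Programs and their running times -/

/-- The program that puts the bits `bs` on top of stack `i`. -/
def pushAll (i : ℕ) : List Bool → Prog
  | [] => .skip
  | b :: bs => .seq (pushAll i bs) (.push i b)

theorem exec_pushAll (O : List Bool → List Bool) (i : ℕ) (bs : List Bool) (s : Store) :
    Exec O (pushAll i bs) s (Function.update s i (bs ++ s i)) (bs.length + 1) := by
  induction bs with
  | nil => simpa [pushAll] using Exec.skip s
  | cons b bs ih =>
    have h := Exec.seq ih (Exec.push (Function.update s i (bs ++ s i)) i b)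
    simpa [pushAll] using h

/-- The program that moves the bits of stack `i` one by one to stack `j`, which reverses their
order. Stack `3` controls the loop. -/
def moveProg (i j : ℕ) : Prog :=
  .seq (.push 3 true) (.loop 3 true (.branch i true (.seq (.pop i) (.push j true))
    (.branch i false (.seq (.pop i) (.push j false)) (.pop 3))))

theorem exec_moveProg (O : List Bool → List Bool) {i j : ℕ} (hij : i ≠ j) (hi : i ≠ 3)
    (hj : j ≠ 3) (s : Store) (h3 : s 3 = []) :
    ∃ t ≤ 6 * (s i).length + 6, Exec O (moveProg i j) s
      (Function.update (Function.update s j ((s i).reverse ++ s j)) i []) t := by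
  have key : ∀ (l : List Bool) (s : Store), s i = l → s 3 = [true] →
      ∃ t ≤ 6 * l.length + 5, Exec O (.loop 3 true (.branch i true (.seq (.pop i) (.push j true))
        (.branch i false (.seq (.pop i) (.push j false)) (.pop 3)))) s
      (Function.update (Function.update (Function.update s j (l.reverse ++ s j)) i []) 3 []) t := by
    intro l
    induction l with
    | nil =>
      intro s hs h3
      refine ⟨1 + 1 + 1 + 1 + 1, by simp, ?_⟩
      refine Exec.loop_step (s' := Function.update s 3 []) (t := 1 + 1 + 1) (u := 1)
        (by simp [h3]) ?_ ?_
      · refine .branch_neg (t := 1 + 1) (by simp [hs]) (.branch_neg (t := 1) (by simp [hs]) ?_)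
        simpa [h3] using Exec.pop (O := O) s 3
      · have : Function.update (Function.update (Function.update s j (([] : List Bool).reverse
            ++ s j)) i []) 3 [] = Function.update s 3 [] := by
          funext k
          simp only [Function.update_apply]
          split_ifs <;> simp_all
        rw [this]
        exact .loop_done (by simp)
    | cons b l ih =>
      intro s hs h3
      obtain ⟨t, ht, hE⟩ := ih (Function.update (Function.update s i l) j (b :: s j))
        (by simp [hij]) (by simp [hi.symm, hj.symm, h3])
      have hb : Exec O (.seq (.pop i) (.push j b)) s
          (Function.update (Function.update s i l) j (b :: s j)) (1 + 1) := by
        have h1 := Exec.pop (O := O) s i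
        have h2 := Exec.push (O := O) (Function.update s i l) j b
        simp only [hs, List.tail_cons] at h1
        simp only [Function.update_of_ne hij.symm] at h2
        exact .seq h1 h2
      have hfin : Function.update (Function.update (Function.update (Function.update
          (Function.update s i l) j (b :: s j)) j (l.reverse ++ Function.update
          (Function.update s i l) j (b :: s j) j)) i []) 3 [] = Function.update (Function.update
          (Function.update s j ((b :: l).reverse ++ s j)) i []) 3 [] := by
        funext k
        simp only [Function.update_apply]
        split_ifs <;> simp_all
      rw [hfin] at hE
      cases b with
      | true =>
        exact ⟨_, by simp only [List.length_cons]; omega,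
          .loop_step (by simp [h3]) (.branch_pos (by simp [hs]) hb) hE⟩
      | false =>
        exact ⟨_, by simp only [List.length_cons]; omega,
          .loop_step (by simp [h3]) (.branch_neg (by simp [hs])
            (.branch_pos (by simp [hs]) hb)) hE⟩
  obtain ⟨t, ht, hE⟩ := key (s i) (Function.update s 3 [true]) (by simp [hi]) (by simp)
  refine ⟨1 + t, by omega, ?_⟩
  have h1 := Exec.push (O := O) s 3 true
  rw [h3] at h1
  have hfin : Function.update (Function.update (Function.update (Function.update s 3 [true]) j
      ((s i).reverse ++ Function.update s 3 [true] j)) i []) 3 [] =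
      Function.update (Function.update s j ((s i).reverse ++ s j)) i [] := by
    funext k
    simp only [Function.update_apply]
    split_ifs <;> simp_all
  rw [hfin] at hE
  exact .seq h1 hE

/-- Renaming of the stacks used by a program. -/
def Prog.rename (ρ : ℕ → ℕ) : Prog → Prog
  | .skip => .skip
  | .push i b => .push (ρ i) b
  | .pop i => .pop (ρ i)
  | .query i => .query (ρ i)
  | .seq P Q => .seq (P.rename ρ) (Q.rename ρ)
  | .branch i b P Q => .branch (ρ i) b (P.rename ρ) (Q.rename ρ)
  | .loop i b P => .loop (ρ i) b (P.rename ρ)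

/-- A renamed program runs on the renamed stacks as the program does on its own, and leaves all
other stacks alone. -/
theorem Exec.rename {O : List Bool → List Bool} {ρ : ℕ → ℕ} (hρ : Function.Injective ρ)
    {P : Prog} {s s' : Store} {t : ℕ} (h : Exec O P s s' t) :
    ∀ u : Store, (∀ i, u (ρ i) = s i) → ∃ u' : Store, Exec O (P.rename ρ) u u' t ∧
      (∀ i, u' (ρ i) = s' i) ∧ ∀ j, (∀ i, j ≠ ρ i) → u' j = u j := by
  have upd : ∀ (u s : Store) (i : ℕ) (x : List Bool), (∀ i, u (ρ i) = s i) →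
      ∀ k, Function.update u (ρ i) x (ρ k) = Function.update s i x k := by
    intro u s i x hu k
    by_cases hk : k = i
    · subst hk; simp
    · rw [Function.update_of_ne (hρ.ne hk), Function.update_of_ne hk, hu]
  induction h with
  | skip s => intro u hu; exact ⟨u, .skip u, hu, fun _ _ => rfl⟩
  | push s i b =>
    intro u hu
    refine ⟨_, .push u (ρ i) b, ?_, fun j hj => Function.update_of_ne (hj i) _ _⟩
    rw [hu i]; exact upd u s i _ hu
  | pop s i =>
    intro u hu
    refine ⟨_, .pop u (ρ i), ?_, fun j hj => Function.update_of_ne (hj i) _ _⟩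
    rw [hu i]; exact upd u s i _ hu
  | query s i =>
    intro u hu
    have h := Exec.query (O := O) u (ρ i)
    rw [hu i] at h
    exact ⟨_, h, upd u s i _ hu, fun j hj => Function.update_of_ne (hj i) _ _⟩
  | seq _ _ ih1 ih2 =>
    intro u hu
    obtain ⟨u1, h1, e1, n1⟩ := ih1 u hu
    obtain ⟨u2, h2, e2, n2⟩ := ih2 u1 e1
    exact ⟨u2, .seq h1 h2, e2, fun j hj => (n2 j hj).trans (n1 j hj)⟩
  | branch_pos hb _ ih =>
    intro u hu
    obtain ⟨u1, h1, e1, n1⟩ := ih u hu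
    exact ⟨u1, .branch_pos (by rw [hu, hb]) h1, e1, n1⟩
  | branch_neg hb _ ih =>
    intro u hu
    obtain ⟨u1, h1, e1, n1⟩ := ih u hu
    exact ⟨u1, .branch_neg (by rw [hu]; exact hb) h1, e1, n1⟩
  | loop_done hb =>
    intro u hu
    exact ⟨u, .loop_done (by rw [hu]; exact hb), hu, fun _ _ => rfl⟩
  | loop_step hb _ _ ih1 ih2 =>
    intro u hu
    obtain ⟨u1, h1, e1, n1⟩ := ih1 u hu
    obtain ⟨u2, h2, e2, n2⟩ := ih2 u1 e1
    exact ⟨u2, .loop_step (by rw [hu, hb]) h1 h2, e2, fun j hj => (n2 j hj).trans (n1 j hj)⟩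

/-! ### Finite automata with auxiliary stacks -/

/-- The names of the auxiliary stacks of an automaton. -/
inductive Reg where
  | out | aux | buf | mem | scr
  deriving DecidableEq

/-- The number of the stack that holds a given auxiliary stack; stacks `0` to `3` hold the input,
the state and the control bits of loops. -/
def Reg.idx : Reg → ℕ
  | .out => 4
  | .aux => 5
  | .buf => 6
  | .mem => 7
  | .scr => 8

/-- The contents of the auxiliary stacks. -/
abbrev Work := Reg → List Bool

/-- The store with the input `l`, the state `a`, the control stacks `b` and `c`, the auxiliary
stacks `u`, and the contents `R` of all stacks from number `9` on. -/
def store (l a b c : List Bool) (u : Work) (R : Store) : Store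
  | 0 => l
  | 1 => a
  | 2 => b
  | 3 => c
  | 4 => u .out
  | 5 => u .aux
  | 6 => u .buf
  | 7 => u .mem
  | 8 => u .scr
  | j + 9 => R j

@[simp] theorem store_idx (l a b c : List Bool) (u : Work) (R : Store) (r : Reg) :
    store l a b c u R r.idx = u r := by
  cases r <;> rfl

theorem update_store_zero (l a b c : List Bool) (u : Work) (R : Store) (x : List Bool) :
    Function.update (store l a b c u R) 0 x = store x a b c u R := by
  funext j
  rcases j with _ | j
  · simp [store]
  · rw [Function.update_of_ne (by omega)]
    rcases j with _ | _ | _ | _ | _ | _ | _ | _ | j <;> rfl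

theorem update_store_one (l a b c : List Bool) (u : Work) (R : Store) (x : List Bool) :
    Function.update (store l a b c u R) 1 x = store l x b c u R := by
  funext j
  rcases j with _ | _ | _ | _ | _ | _ | _ | _ | _ | j <;> simp [store]

theorem update_store_two (l a b c : List Bool) (u : Work) (R : Store) (x : List Bool) :
    Function.update (store l a b c u R) 2 x = store l a x c u R := by
  funext j
  rcases j with _ | _ | _ | _ | _ | _ | _ | _ | _ | j <;> simp [store]

theorem update_store_idx (l a b c : List Bool) (u : Work) (R : Store) (r : Reg) (x : List Bool) :
    Function.update (store l a b c u R) r.idx x = store l a b c (Function.update u r x) R := by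
  funext j
  cases r <;> rcases j with _ | _ | _ | _ | _ | _ | _ | _ | _ | j <;>
    simp [store, Reg.idx]

theorem Reg.idx_injective : Function.Injective Reg.idx := by
  intro r r' h
  cases r <;> cases r' <;> simp_all [Reg.idx]

theorem Reg.idx_ne (r : Reg) {k : ℕ} (hk : k < 4) : r.idx ≠ k := by
  cases r <;> simp only [Reg.idx] <;> omega

/-- The total number of bits on the auxiliary stacks. -/
def Work.size (u : Work) : ℕ :=
  (u .out).length + (u .aux).length + (u .buf).length + (u .mem).length + (u .scr).length

theorem Work.size_update (u : Work) (r : Reg) (x : List Bool) :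
    Work.size (Function.update u r x) + (u r).length = Work.size u + x.length := by
  cases r <;> simp [Work.size] <;> omega

theorem Work.length_le_size (u : Work) (r : Reg) : (u r).length ≤ Work.size u := by
  cases r <;> simp only [Work.size] <;> omega

/-- The elementary actions of an automaton on its auxiliary stacks. Moving a stack to another one
reverses it. -/
inductive Act where
  | push (r : Reg) (b : Bool)
  | pop (r : Reg)
  | move (r r' : Reg)

/-- The effect of an action. -/
def Act.run : Act → Work → Work
  | .push r b, u => Function.update u r (b :: u r)
  | .pop r, u => Function.update u r (u r).tail
  | .move r r', u =>
    if r = r' then u else Function.update (Function.update u r' ((u r).reverse ++ u r')) r []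

/-- The program of an action. -/
def Act.prog : Act → Prog
  | .push r b => .push r.idx b
  | .pop r => .pop r.idx
  | .move r r' => if r = r' then .skip else moveProg r.idx r'.idx

theorem Act.size_run (A : Act) (u : Work) : Work.size (A.run u) ≤ Work.size u + 1 := by
  cases A with
  | push r b =>
    have h := Work.size_update u r (b :: u r)
    simp only [List.length_cons] at h
    simp only [Act.run]; omega
  | pop r =>
    have h := Work.size_update u r (u r).tail
    simp only [List.length_tail] at h
    simp only [Act.run]; omega
  | move r r' =>
    simp only [Act.run]
    split_ifs with hr
    · omega
    · have h := Work.size_update u r' ((u r).reverse ++ u r')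
      have h' := Work.size_update (Function.update u r' ((u r).reverse ++ u r')) r []
      rw [Function.update_of_ne hr] at h'
      simp only [List.length_append, List.length_reverse, List.length_nil] at h h'
      omega

theorem Act.exec (O : List Bool → List Bool) (A : Act) (l a b : List Bool) (u : Work) (R : Store) :
    ∃ t ≤ 6 * Work.size u + 6,
      Exec O A.prog (store l a b [] u R) (store l a b [] (A.run u) R) t := by
  cases A with
  | push r x =>
    have h := Exec.push (O := O) (store l a b [] u R) r.idx x
    rw [store_idx, update_store_idx] at h
    exact ⟨1, by omega, h⟩
  | pop r =>
    have h := Exec.pop (O := O) (store l a b [] u R) r.idx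
    rw [store_idx, update_store_idx] at h
    exact ⟨1, by omega, h⟩
  | move r r' =>
    by_cases hr : r = r'
    · simp only [Act.prog, Act.run, if_pos hr]
      exact ⟨1, by omega, .skip _⟩
    · obtain ⟨t, ht, h⟩ := exec_moveProg O (Reg.idx_injective.ne hr) (r.idx_ne (by norm_num))
        (r'.idx_ne (by norm_num)) (store l a b [] u R) rfl
      rw [store_idx, store_idx, update_store_idx, update_store_idx] at h
      rw [store_idx] at ht
      have := u.length_le_size r
      simp only [Act.prog, Act.run, if_neg hr]
      exact ⟨t, by omega, h⟩

/-- The effect of a list of actions. -/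
def runActs (L : List Act) (u : Work) : Work := L.foldl (fun v A => A.run v) u

/-- The program of a list of actions. -/
def actsProg : List Act → Prog
  | [] => .skip
  | A :: L => .seq A.prog (actsProg L)

@[simp] theorem runActs_nil (u : Work) : runActs [] u = u := rfl

@[simp] theorem runActs_cons (A : Act) (L : List Act) (u : Work) :
    runActs (A :: L) u = runActs L (A.run u) := rfl

theorem runActs_append (L L' : List Act) (u : Work) :
    runActs (L ++ L') u = runActs L' (runActs L u) := by
  simp [runActs]

theorem size_runActs (L : List Act) (u : Work) :
    Work.size (runActs L u) ≤ Work.size u + L.length := by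
  induction L generalizing u with
  | nil => simp
  | cons A L ih =>
    have h1 := A.size_run u
    have h2 := ih (A.run u)
    simp only [runActs_cons, List.length_cons]; omega

theorem exec_actsProg (O : List Bool → List Bool) (L : List Act) (l a b : List Bool) (u : Work)
    (R : Store) : ∃ t ≤ L.length * (6 * (Work.size u + L.length) + 6) + 1,
      Exec O (actsProg L) (store l a b [] u R) (store l a b [] (runActs L u) R) t := by
  induction L generalizing u with
  | nil => exact ⟨1, by simp, .skip _⟩
  | cons A L ih =>
    obtain ⟨t1, ht1, h1⟩ := A.exec O l a b u R
    obtain ⟨t2, ht2, h2⟩ := ih (A.run u)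
    have hs := A.size_run u
    refine ⟨t1 + t2, ?_, .seq h1 h2⟩
    have h : L.length * (6 * (Work.size (A.run u) + L.length) + 6) ≤
        L.length * (6 * (Work.size u + (L.length + 1)) + 6) :=
      Nat.mul_le_mul_left _ (by omega)
    have e : ∀ E, (L.length + 1) * E = L.length * E + E := fun E => by ring
    rw [List.length_cons, e]
    omega

/-- An automaton that reads its input bit by bit. In every step it sees its state, the next input
bit and the top bit of the stack `mem`, and determines the new state and a list of actions on the
auxiliary stacks. At the end of the input it performs a list of actions that depends on its
state. -/
structure Automaton where
  Q : Type
  finite : Finite Q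
  init : Q
  next : Q → Bool → Option Bool → Q × List Act
  final : Q → List Act

namespace Automaton

variable (M : Automaton)

/-- One step of an automaton. -/
def step (c : M.Q × Work) (b : Bool) : M.Q × Work :=
  ((M.next c.1 b (c.2 .mem).head?).1, runActs (M.next c.1 b (c.2 .mem).head?).2 c.2)

/-- The auxiliary stacks after a complete run of the automaton. -/
def result (l : List Bool) (u : Work) : Work :=
  let c := l.foldl M.step (M.init, u)
  runActs (M.final c.1) c.2

end Automaton

/-- Executes the program in the list whose position is stored on stack `1` in unary, and clears
that stack first. -/
def switch : List Prog → Prog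
  | [] => .skip
  | P :: L => .branch 1 true (.seq (.pop 1) (switch L)) P

theorem exec_switch (O : List Bool → List Bool) {b : List Bool} {l a' l' b' : List Bool}
    {u u' : Work} {R : Store} {t : ℕ} (L : List Prog) (q : ℕ) (P : Prog) (hq : L[q]? = some P)
    (h : Exec O P (store l [] b [] u R) (store l' a' b' [] u' R) t) :
    Exec O (switch L) (store l (List.replicate q true) b [] u R) (store l' a' b' [] u' R)
      (t + 2 * q + 1) := by
  induction L generalizing q with
  | nil => simp at hq
  | cons P' L ih =>
    cases q with
    | zero =>
      obtain rfl : P' = P := by simpa using hq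
      exact .branch_neg (by simp [store]) h
    | succ q =>
      have h1 := Exec.pop (O := O) (store l (List.replicate (q + 1) true) b [] u R) 1
      rw [update_store_one] at h1
      have h2 := Exec.branch_pos (Q := P') (i := 1) (b := true)
        (s := store l (List.replicate (q + 1) true) b [] u R) (by simp [store, List.replicate_succ])
        (Exec.seq (by simpa [store, List.replicate_succ] using h1) (ih q (by simpa using hq)))
      have e : t + 2 * (q + 1) + 1 = 1 + (t + 2 * q + 1) + 1 := by ring
      rw [e]
      exact h2

/-- The program that uses a list of programs for the different states: run the program of the
current state. -/
theorem exists_dispatch {N : ℕ} (p : Fin N → Prog) :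
    ∃ P : Prog, ∀ (O : List Bool → List Bool) (q : Fin N) {b l a' l' b' : List Bool}
      {u u' : Work} {R : Store} {t : ℕ},
      Exec O (p q) (store l [] b [] u R) (store l' a' b' [] u' R) t →
      Exec O P (store l (List.replicate q true) b [] u R) (store l' a' b' [] u' R)
        (t + 2 * q + 1) :=
  ⟨switch (List.ofFn p), fun O q _ _ _ _ _ _ _ _ _ h =>
    exec_switch O (List.ofFn p) q (p q) (by simp) h⟩

/-- The loop that consumes the input bit by bit, with one program for every bit. -/
theorem exec_inputLoop (O : List Bool → List Bool) (P : Bool → Prog) {X : Type}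
    (code : X → List Bool) (F : X × Work → Bool → X × Work) (R : Store) (A k : ℕ)
    (hP : ∀ b x u l, ∃ t ≤ A * (Work.size u + 1), Exec O (P b) (store l (code x) [true] [] u R)
      (store l (code (F (x, u) b).1) [true] [] (F (x, u) b).2 R) t)
    (hF : ∀ b x u, Work.size (F (x, u) b).2 ≤ Work.size u + k) (l : List Bool) (x : X) (u : Work)
    (Z : ℕ) (hZ : Work.size u + k * l.length ≤ Z) :
    ∃ t ≤ (l.length + 1) * (A * (Z + 1) + 6), Exec O
      (.loop 2 true (.branch 0 true (.seq (.pop 0) (P true))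
        (.branch 0 false (.seq (.pop 0) (P false)) (.pop 2))))
      (store l (code x) [true] [] u R)
      (store [] (code (l.foldl F (x, u)).1) [] [] (l.foldl F (x, u)).2 R) t := by
  induction l generalizing x u with
  | nil =>
    refine ⟨1 + 1 + 1 + 1 + 1, by simp, ?_⟩
    refine Exec.loop_step (t := 1 + 1 + 1) (u := 1) (by simp [store])
      (.branch_neg (t := 1 + 1) (by simp [store]) (.branch_neg (t := 1) (by simp [store])
        (.pop _ _))) ?_
    rw [update_store_two]
    exact .loop_done (by simp [store])
  | cons b l ih =>
    obtain ⟨t1, ht1, h1⟩ := hP b x u l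
    have hF' := hF b x u
    rw [List.length_cons, mul_add, mul_one] at hZ
    obtain ⟨t2, ht2, h2⟩ := ih (F (x, u) b).1 (F (x, u) b).2 (by omega)
    have hpop := Exec.pop (O := O) (store (b :: l) (code x) [true] [] u R) 0
    rw [update_store_zero] at hpop
    have hbody : Exec O (.seq (.pop 0) (P b)) (store (b :: l) (code x) [true] [] u R)
        (store l (code (F (x, u) b).1) [true] [] (F (x, u) b).2 R) (1 + t1) := .seq hpop h1
    have ht1' : t1 ≤ A * (Z + 1) := ht1.trans (by gcongr; omega)
    have hlen : (l.length + 1 + 1) * (A * (Z + 1) + 6) =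
        (l.length + 1) * (A * (Z + 1) + 6) + (A * (Z + 1) + 6) := by ring
    rw [List.length_cons, hlen]
    cases b with
    | true =>
      exact ⟨_, by omega, .loop_step (by simp [store])
        (.branch_pos (by simp [store]) hbody) h2⟩
    | false =>
      exact ⟨_, by omega, .loop_step (by simp [store])
        (.branch_neg (by simp [store]) (.branch_pos (by simp [store]) hbody)) h2⟩

/-! ### Polynomial-time transformations of the store -/

/-- `Computes F`: some program without oracle calls transforms the input stack and the auxiliary
stacks by `F`, in polynomial time and with polynomially bounded results. -/
def Computes (F : List Bool × Work → List Bool × Work) : Prop :=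
  ∃ (P : Prog) (p : Polynomial ℕ), ∀ (O : List Bool → List Bool) (c : List Bool × Work) (R : Store),
    ∃ t, t + (F c).1.length + Work.size (F c).2 ≤ p.eval (c.1.length + Work.size c.2) ∧
      Exec O P (store c.1 [] [] [] c.2 R) (store (F c).1 [] [] [] (F c).2 R) t

theorem polynomial_eval_mono (p : Polynomial ℕ) {m n : ℕ} (h : m ≤ n) : p.eval m ≤ p.eval n := by
  simp only [Polynomial.eval_eq_sum, Polynomial.sum]
  gcongr

theorem Computes.comp {F G : List Bool × Work → List Bool × Work} (hG : Computes G)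
    (hF : Computes F) : Computes fun c => G (F c) := by
  obtain ⟨P, p, hP⟩ := hF
  obtain ⟨Q, q, hQ⟩ := hG
  refine ⟨.seq P Q, p + q.comp p, fun O c R => ?_⟩
  obtain ⟨t, ht, h⟩ := hP O c R
  obtain ⟨t', ht', h'⟩ := hQ O (F c) R
  refine ⟨t + t', ?_, .seq h h'⟩
  have := polynomial_eval_mono q (show (F c).1.length + Work.size (F c).2 ≤ _ by
    exact le_trans (by omega) ht)
  rw [Polynomial.eval_add, Polynomial.eval_comp]
  dsimp only
  omega

/-- Moving an auxiliary stack in front of the input. -/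
theorem Computes.load (r : Reg) :
    Computes fun c => ((c.2 r).reverse ++ c.1, Function.update c.2 r []) := by
  refine ⟨moveProg r.idx 0, 10 * Polynomial.X + 6, fun O c R => ?_⟩
  obtain ⟨t, ht, h⟩ := exec_moveProg O (r.idx_ne (k := 0) (by norm_num)) (r.idx_ne (by norm_num))
    (by norm_num) (store c.1 [] [] [] c.2 R) rfl
  rw [store_idx, update_store_zero, update_store_idx] at h
  rw [store_idx] at ht
  refine ⟨t, ?_, h⟩
  have h1 := c.2.length_le_size r
  have h2 := c.2.size_update r []
  simp only [List.length_append, List.length_reverse, Polynomial.eval_add, Polynomial.eval_mul,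
    Polynomial.eval_X, Polynomial.eval_ofNat, List.length_nil] at h2 ⊢
  omega

/-- Every automaton can be run in polynomial time: its state is kept in unary on a stack of its
own. -/
theorem Automaton.computes (M : Automaton) : Computes fun c => ([], M.result c.1 c.2) := by
  obtain ⟨N, ⟨e⟩⟩ := @Finite.exists_equiv_fin M.Q M.finite
  have := M.finite
  -- a bound for the number of actions in a single step
  obtain ⟨k, hk⟩ : ∃ k, ∀ q b o, (M.next q b o).2.length ≤ k ∧ (M.final q).length ≤ k := by
    obtain ⟨k, hk⟩ := (Set.finite_range fun z : M.Q × Bool × Option Bool =>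
      (M.next z.1 z.2.1 z.2.2).2.length + (M.final z.1).length).bddAbove
    exact ⟨k, fun q b o => by
      have := hk ⟨(q, b, o), rfl⟩
      dsimp only at this
      omega⟩
  let code : M.Q → List Bool := fun q => List.replicate (e q) true
  let act : Bool → Option Bool → Fin N → Prog := fun b o i =>
    .seq (actsProg (M.next (e.symm i) b o).2) (pushAll 1 (code (M.next (e.symm i) b o).1))
  choose D hD using fun p : Fin N → Prog => exists_dispatch p
  -- stack `7` holds `mem`
  let body : Bool → Prog := fun b => D fun i =>
    .branch 7 true (act b (some true) i) (.branch 7 false (act b (some false) i) (act b none i))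
  have hact : ∀ O b q o l u R, ∃ t ≤ k * (6 * (Work.size u + k) + 6) + N + 3,
      Exec O (act b o (e q)) (store l [] [true] [] u R)
        (store l (code (M.next q b o).1) [true] [] (runActs (M.next q b o).2 u) R) t := by
    intro O b q o l u R
    obtain ⟨t, ht, h⟩ := exec_actsProg O (M.next q b o).2 l [] [true] u R
    have h' := exec_pushAll O 1 (code (M.next q b o).1)
      (store l [] [true] [] (runActs (M.next q b o).2 u) R)
    rw [update_store_one] at h'
    refine ⟨t + ((code (M.next q b o).1).length + 1), ?_, ?_⟩
    · have h1 : (code (M.next q b o).1).length ≤ N := by simp [code, (e _).isLt.le]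
      have h2 := (hk q b o).1
      have h3 : (M.next q b o).2.length * (6 * (Work.size u + (M.next q b o).2.length) + 6) ≤
        k * (6 * (Work.size u + k) + 6) := by gcongr
      omega
    · simp only [act, Equiv.symm_apply_apply]
      exact .seq h (by simpa [store] using h')
  have hbody : ∀ O b q u l R, ∃ t ≤ (6 * k * k + 6 * k + 3 * N + 8) * (Work.size u + 1),
      Exec O (body b) (store l (code q) [true] [] u R)
        (store l (code (M.step (q, u) b).1) [true] [] (M.step (q, u) b).2 R) t := by
    intro O b q u l R
    obtain ⟨t, ht, h⟩ := hact O b q (u .mem).head? l u R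
    have h7 : store l [] [true] [] u R 7 = u .mem := rfl
    have hbr : ∃ t' ≤ t + 2, Exec O (.branch 7 true (act b (some true) (e q))
        (.branch 7 false (act b (some false) (e q)) (act b none (e q))))
        (store l [] [true] [] u R)
        (store l (code (M.step (q, u) b).1) [true] [] (M.step (q, u) b).2 R) t' := by
      rcases ho : (u .mem).head? with _ | _ | _
      · rw [ho] at h
        refine ⟨t + 1 + 1, le_rfl, .branch_neg (by rw [h7, ho]; simp)
          (.branch_neg (by rw [h7, ho]; simp) ?_)⟩
        simpa only [step, ho] using h
      · rw [ho] at h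
        refine ⟨t + 1 + 1, le_rfl, .branch_neg (by rw [h7, ho]; simp)
          (.branch_pos (by rw [h7, ho]) ?_)⟩
        simpa only [step, ho] using h
      · rw [ho] at h
        refine ⟨t + 1, by omega, .branch_pos (by rw [h7, ho]) ?_⟩
        simpa only [step, ho] using h
    obtain ⟨t', ht', h'⟩ := hbr
    refine ⟨t' + 2 * (e q) + 1, ?_, hD _ O (e q) h'⟩
    have := (e q).isLt
    nlinarith [Nat.zero_le (Work.size u), Nat.zero_le (Work.size u * k * k),
      Nat.zero_le (Work.size u * N)]
  refine ⟨.seq (pushAll 1 (code M.init)) (.seq (.push 2 true) (.seq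
    (.loop 2 true (.branch 0 true (.seq (.pop 0) (body true))
        (.branch 0 false (.seq (.pop 0) (body false)) (.pop 2))))
    (D fun i => actsProg (M.final (e.symm i))))),
    ((Polynomial.X + 1) * (((6 * k * k + 6 * k + 3 * N + 8 : ℕ) : Polynomial ℕ) *
        (((k + 1 : ℕ) : Polynomial ℕ) * Polynomial.X + 1) + 6)) +
      (k : Polynomial ℕ) * (6 * (((k + 1 : ℕ) : Polynomial ℕ) * Polynomial.X +
        (k : Polynomial ℕ)) + 6) +
      ((k + 1 : ℕ) : Polynomial ℕ) * Polynomial.X + ((3 * N + k + 10 : ℕ) : Polynomial ℕ),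
    fun O c R => ?_⟩
  obtain ⟨l, u⟩ := c
  have hF : ∀ b q u, Work.size (M.step (q, u) b).2 ≤ Work.size u + k := fun b q u =>
    (size_runActs _ u).trans (Nat.add_le_add_left (hk q b _).1 _)
  have hsize : ∀ (l : List Bool) (c : M.Q × Work),
      Work.size (l.foldl M.step c).2 ≤ Work.size c.2 + k * l.length := by
    intro l
    induction l with
    | nil => intro c; simp
    | cons b l ih =>
      intro c
      have h1 := ih (M.step c b)
      have h2 := hF b c.1 c.2
      simp only [List.foldl_cons, List.length_cons, mul_add]
      simp only [Prod.mk.eta] at h2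
      omega
  have h1 := exec_pushAll O 1 (code M.init) (store l [] [] [] u R)
  rw [update_store_one, show store l [] [] [] u R 1 = [] from rfl, List.append_nil] at h1
  have h2 := Exec.push (O := O) (store l (code M.init) [] [] u R) 2 true
  rw [update_store_two, show store l (code M.init) [] [] u R 2 = [] from rfl] at h2
  have hZ : Work.size u + k * l.length ≤ (k + 1) * (l.length + Work.size u) := by nlinarith
  obtain ⟨t3, ht3, h3⟩ := exec_inputLoop O body code M.step R (6 * k * k + 6 * k + 3 * N + 8) k
    (fun b q u l => hbody O b q u l R) hF l M.init u _ hZ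
  set q := (l.foldl M.step (M.init, u)).1 with hq
  set v := (l.foldl M.step (M.init, u)).2 with hv
  have hv' : Work.size v ≤ (k + 1) * (l.length + Work.size u) := (hsize l (M.init, u)).trans hZ
  obtain ⟨t4, ht4, h4⟩ := exec_actsProg O (M.final q) [] [] [] v R
  have h4' := hD (fun i => actsProg (M.final (e.symm i))) O (e q) (by simpa using h4)
  refine ⟨_, ?_, .seq h1 (.seq h2 (.seq h3 h4'))⟩
  have hk' := (hk q true none).2
  have h5 := size_runActs (M.final q) v
  have h6 : (M.final q).length * (6 * (Work.size v + (M.final q).length) + 6) ≤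
      k * (6 * ((k + 1) * (l.length + Work.size u) + k) + 6) := by gcongr
  have h7 : t3 ≤ (l.length + Work.size u + 1) * ((6 * k * k + 6 * k + 3 * N + 8) *
      ((k + 1) * (l.length + Work.size u) + 1) + 6) :=
    ht3.trans (Nat.mul_le_mul_right _ (by omega))
  have h8 : (code M.init).length ≤ N := by simp [code, (e _).isLt.le]
  have h9 := (e q).isLt
  have h10 : M.result l u = runActs (M.final q) v := rfl
  simp only [Polynomial.eval_add, Polynomial.eval_mul, Polynomial.eval_natCast, Polynomial.eval_X,
    Polynomial.eval_ofNat, Polynomial.eval_one, h10, List.length_nil, Nat.cast_id]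
  omega

/-! ### Reading a signature grid vertex by vertex -/

/-- The three kinds of vertices of a grid. In the first half of the theorem `f` stands for the LHS
signature, `g` for the RHS signature and `w` for the unary RHS signature (or the straddled signature
replacing it); in the second half the two sides are exchanged. In both halves the variables of a
vertex of kind `f` are joined to those of the vertices of kinds `g` and `w`. -/
inductive Kind where
  | f | g | w
  deriving DecidableEq

instance : Finite Kind :=
  Finite.of_injective (fun κ : Kind => (κ = .f, κ = .g)) (by
    intro κ κ' h
    cases κ <;> cases κ' <;> simp_all)

/-- The label of a kind of vertices; `flip` says that the two sides are exchanged. -/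
def Kind.label (flip : Bool) : Kind → Fin 3
  | .f => if flip then 1 else 0
  | .g => if flip then 0 else 1
  | .w => 2

/-- The kind with a given label. -/
def Kind.ofLabel (flip : Bool) (i : Fin 3) : Kind :=
  if i = 2 then .w else if i = Kind.label flip .f then .f else .g

@[simp] theorem Kind.ofLabel_label (flip : Bool) (κ : Kind) :
    Kind.ofLabel flip (κ.label flip) = κ := by
  cases flip <;> cases κ <;> rfl

@[simp] theorem Kind.label_ofLabel (flip : Bool) (i : Fin 3) :
    (Kind.ofLabel flip i).label flip = i := by
  cases flip <;> fin_cases i <;> rfl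

/-- A vertex given by its kind and the names of the edges at it. -/
abbrev Node := Kind × List ℕ

/-- The numbers that make up the encoding of a list of vertices. -/
def tokens (flip : Bool) (V : List Node) : List ℕ :=
  V.flatMap fun v => (v.1.label flip : ℕ) :: v.2

theorem encodeNats_cons (k : ℕ) (L : List ℕ) :
    encodeNats (k :: L) = List.replicate k true ++ false :: encodeNats L := by
  simp [encodeNats]

theorem encodeNats_append (L L' : List ℕ) :
    encodeNats (L ++ L') = encodeNats L ++ encodeNats L' := by
  simp [encodeNats]

@[simp] theorem encodeNats_nil : encodeNats [] = [] := rfl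

/-- The actions that push the bits `bs` one after the other, so that they end up reversed. -/
def pushes (r : Reg) (bs : List Bool) : List Act := bs.map (Act.push r)

@[simp] theorem runActs_pushes (r : Reg) (bs : List Bool) (u : Work) :
    runActs (pushes r bs) u = Function.update u r (bs.reverse ++ u r) := by
  induction bs generalizing u with
  | nil => simp [pushes]
  | cons b bs ih =>
    simp only [pushes, List.map_cons, runActs_cons] at ih ⊢
    rw [ih]
    simp [Act.run]

/-- An automaton with a finite memory `X` described by its reaction to the parts of an encoded list
of vertices: to a label, to a single bit of the name of an edge, to the end of that name (knowing
the position of the edge at the vertex), and to the end of the vertex. The optional bit is the top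
bit of the stack `mem`. -/
structure Parser where
  X : Type
  finite : Finite X
  init : X
  label : Kind → X → X × List Act
  bit : Kind → Option Bool → List Act
  edge : Kind → ℕ → X → Option Bool → X × List Act
  close : Kind → X → X × List Act
  final : X → List Act

namespace Parser

variable (M : Parser)

/-- The reaction to a label. -/
def doLabel (κ : Kind) (c : M.X × Work) : M.X × Work :=
  ((M.label κ c.1).1, runActs (M.label κ c.1).2 c.2)

/-- The reaction to a bit of the name of an edge. -/
def doBit (κ : Kind) (c : M.X × Work) : M.X × Work :=
  (c.1, runActs (M.bit κ (c.2 .mem).head?) c.2)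

/-- The reaction to the end of the name of an edge. -/
def doEdge (κ : Kind) (j : ℕ) (c : M.X × Work) : M.X × Work :=
  ((M.edge κ j c.1 (c.2 .mem).head?).1, runActs (M.edge κ j c.1 (c.2 .mem).head?).2 c.2)

/-- The reaction to the end of a vertex. -/
def doClose (κ : Kind) (c : M.X × Work) : M.X × Work :=
  ((M.close κ c.1).1, runActs (M.close κ c.1).2 c.2)

/-- The reaction to the whole name `e` of an edge. -/
def readEdge (κ : Kind) (j e : ℕ) (c : M.X × Work) : M.X × Work :=
  M.doEdge κ j ((M.doBit κ)^[e] c)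

/-- The reaction to the names of several edges, the first of which has position `j`. -/
def readEdges (κ : Kind) : ℕ → List ℕ → M.X × Work → M.X × Work
  | _, [], c => c
  | j, e :: es, c => readEdges κ (j + 1) es (M.readEdge κ j e c)

/-- The reaction to a vertex. -/
def readNode (c : M.X × Work) (v : Node) : M.X × Work :=
  M.doClose v.1 (M.readEdges v.1 0 v.2 (M.doLabel v.1 c))

/-- The auxiliary stacks after reading a list of vertices. -/
def result (V : List Node) (u : Work) : Work :=
  let c := V.foldl M.readNode (M.init, u)
  runActs (M.final c.1) c.2

/-- The automaton of a parser, for vertices with arities `ar`. It remembers the part of the label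
read so far, or the kind of the vertex and the position of the edge. -/
abbrev automaton (flip : Bool) (ar : Kind → ℕ) : Automaton where
  Q := (Fin 3 ⊕ Kind × Fin (ar .f + ar .g + ar .w + 1)) × M.X
  finite := by
    have := M.finite
    infer_instance
  init := (.inl 0, M.init)
  next q b o :=
    match q, b with
    | (.inl i, x), true => ((.inl (if i = 0 then 1 else 2), x), [])
    | (.inl i, x), false =>
      let κ := Kind.ofLabel flip i
      let r := M.label κ x
      if ar κ = 0 then
        ((.inl 0, (M.close κ r.1).1), r.2 ++ (M.close κ r.1).2)
      else
        ((.inr (κ, 0), r.1), r.2)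
    | (.inr (κ, j), x), true => ((.inr (κ, j), x), M.bit κ o)
    | (.inr (κ, j), x), false =>
      let r := M.edge κ j x o
      if ar κ = j + 1 then
        ((.inl 0, (M.close κ r.1).1), r.2 ++ (M.close κ r.1).2)
      else
        ((.inr (κ, Fin.ofNat _ (j + 1)), r.1), r.2)
  final q := M.final q.2

variable {flip : Bool} {ar : Kind → ℕ}

theorem foldl_step_bits (κ : Kind) (j : Fin (ar .f + ar .g + ar .w + 1)) (e : ℕ)
    (c : M.X × Work) :
    (List.replicate e true).foldl (M.automaton flip ar).step ((.inr (κ, j), c.1), c.2) =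
      ((.inr (κ, j), ((M.doBit κ)^[e] c).1), ((M.doBit κ)^[e] c).2) := by
  induction e generalizing c with
  | zero => rfl
  | succ e ih =>
    rw [List.replicate_succ, List.foldl_cons, Function.iterate_succ_apply, ← ih]
    rfl

theorem ar_le_sum (κ : Kind) : ar κ ≤ ar .f + ar .g + ar .w := by
  cases κ <;> omega

theorem foldl_step_edges (κ : Kind) (j : ℕ) (es : List ℕ) (c : M.X × Work) (hes : es ≠ [])
    (hj : j + es.length = ar κ) :
    (encodeNats es).foldl (M.automaton flip ar).step ((.inr (κ, Fin.ofNat _ j), c.1), c.2) =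
      ((.inl 0, (M.doClose κ (M.readEdges κ j es c)).1),
        (M.doClose κ (M.readEdges κ j es c)).2) := by
  have hκ := ar_le_sum (ar := ar) κ
  induction es generalizing j c with
  | nil => exact absurd rfl hes
  | cons e es ih =>
    rw [List.length_cons] at hj
    have hmod : j % (ar .f + ar .g + ar .w + 1) = j := Nat.mod_eq_of_lt (by omega)
    rw [encodeNats_cons, List.foldl_append, foldl_step_bits, List.foldl_cons]
    have hval : (Fin.ofNat (ar .f + ar .g + ar .w + 1) j : ℕ) = j := hmod
    by_cases h : es = []
    · subst h
      simp only [List.length_nil, zero_add] at hj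
      have : (M.automaton flip ar).step ((.inr (κ, Fin.ofNat _ j), ((M.doBit κ)^[e] c).1),
          ((M.doBit κ)^[e] c).2) false =
          ((.inl 0, (M.doClose κ (M.readEdge κ j e c)).1),
            (M.doClose κ (M.readEdge κ j e c)).2) := by
        simp only [Automaton.step, automaton, hval, hj, if_true]
        rw [runActs_append]
        rfl
      rw [this]
      rfl
    · have h' : ar κ ≠ j + 1 := by
        have := List.length_pos_iff.2 h
        omega
      have : (M.automaton flip ar).step ((.inr (κ, Fin.ofNat _ j), ((M.doBit κ)^[e] c).1),
          ((M.doBit κ)^[e] c).2) false =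
          ((.inr (κ, Fin.ofNat _ (j + 1)), (M.readEdge κ j e c).1), (M.readEdge κ j e c).2) := by
        simp only [Automaton.step, automaton, hval, h', if_false]
        rfl
      rw [this, ih (j + 1) (M.readEdge κ j e c) h (by omega)]
      rfl

theorem foldl_step_node (v : Node) (hv : v.2.length = ar v.1) (c : M.X × Work) :
    (encodeNats ((v.1.label flip : ℕ) :: v.2)).foldl (M.automaton flip ar).step
      ((.inl 0, c.1), c.2) = ((.inl 0, (M.readNode c v).1), (M.readNode c v).2) := by
  have hlab : (List.replicate (v.1.label flip : ℕ) true).foldl (M.automaton flip ar).step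
      ((.inl 0, c.1), c.2) = ((.inl (v.1.label flip), c.1), c.2) := by
    generalize v.1.label flip = i
    fin_cases i <;> rfl
  rw [encodeNats_cons, List.foldl_append, hlab, List.foldl_cons]
  by_cases h : ar v.1 = 0
  · have hv' : v.2 = [] := List.eq_nil_of_length_eq_zero (hv.trans h)
    have : (M.automaton flip ar).step ((.inl (v.1.label flip), c.1), c.2) false =
        ((.inl 0, (M.readNode c v).1), (M.readNode c v).2) := by
      simp only [Automaton.step, automaton, Kind.ofLabel_label, h, if_true]
      rw [runActs_append]
      simp only [readNode, hv']
      rfl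
    rw [this, hv']
    rfl
  · have hv' : v.2 ≠ [] := fun h' => h (by rw [← hv, h']; rfl)
    have : (M.automaton flip ar).step ((.inl (v.1.label flip), c.1), c.2) false =
        ((.inr (v.1, Fin.ofNat _ 0), (M.doLabel v.1 c).1), (M.doLabel v.1 c).2) := by
      simp only [Automaton.step, automaton, Kind.ofLabel_label, h, if_false]
      rfl
    rw [this, foldl_step_edges M v.1 0 v.2 _ hv' (by simpa using hv)]
    rfl

/-- On the encoding of a list of vertices the automaton works vertex by vertex. -/
theorem automaton_result (V : List Node) (hV : ∀ v ∈ V, v.2.length = ar v.1) (u : Work) :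
    (M.automaton flip ar).result (encodeNats (tokens flip V)) u = M.result V u := by
  have key : ∀ (V : List Node) (c : M.X × Work), (∀ v ∈ V, v.2.length = ar v.1) →
      (encodeNats (tokens flip V)).foldl (M.automaton flip ar).step ((.inl 0, c.1), c.2) =
        ((.inl 0, (V.foldl M.readNode c).1), (V.foldl M.readNode c).2) := by
    intro V
    induction V with
    | nil => intro c _; rfl
    | cons v V ih =>
      intro c hV
      have h : tokens flip (v :: V) = ((v.1.label flip : ℕ) :: v.2) ++ tokens flip V := by
        simp [tokens]
      rw [h, encodeNats_append, List.foldl_append,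
        foldl_step_node M v (hV v (by simp)) c, List.foldl_cons]
      exact ih _ fun v hv => hV v (by simp [hv])
  have h := key V (M.init, u) hV
  simp only [Automaton.result, Parser.result]
  rw [h]

end Parser

/-- The auxiliary stacks with the given contents. -/
def mkWork (out aux buf mem scr : List Bool) : Work
  | .out => out
  | .aux => aux
  | .buf => buf
  | .mem => mem
  | .scr => scr

section mkWork

variable (out aux buf mem scr : List Bool)

@[simp] theorem mkWork_out : mkWork out aux buf mem scr .out = out := rfl

@[simp] theorem mkWork_aux : mkWork out aux buf mem scr .aux = aux := rfl

@[simp] theorem mkWork_buf : mkWork out aux buf mem scr .buf = buf := rfl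

@[simp] theorem mkWork_mem : mkWork out aux buf mem scr .mem = mem := rfl

@[simp] theorem mkWork_scr : mkWork out aux buf mem scr .scr = scr := rfl

end mkWork

theorem Work.ext_iff {u v : Work} : u = v ↔ u .out = v .out ∧ u .aux = v .aux ∧
    u .buf = v .buf ∧ u .mem = v .mem ∧ u .scr = v .scr := by
  refine ⟨fun h => by simp [h], fun ⟨h1, h2, h3, h4, h5⟩ => funext fun r => ?_⟩
  cases r <;> assumption

/-- The encoding of a single vertex, as a list of numbers. -/
def nodeTokens (flip : Bool) (v : Node) : List ℕ := (v.1.label flip : ℕ) :: v.2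

/-- Renaming the edges at a vertex. -/
def Node.rename (φ : ℕ → ℕ) (v : Node) : Node := (v.1, v.2.map φ)

theorem tokens_cons (flip : Bool) (v : Node) (V : List Node) :
    tokens flip (v :: V) = nodeTokens flip v ++ tokens flip V := by
  simp [tokens, nodeTokens]

theorem tokens_append (flip : Bool) (V W : List Node) :
    tokens flip (V ++ W) = tokens flip V ++ tokens flip W := by
  simp [tokens]

theorem encodeNats_singleton (k : ℕ) : encodeNats [k] = List.replicate k true ++ [false] := by
  simp [encodeNats]

/-! ### The disjoint union with a gadget -/

/-- The parser that doubles the names of all edges, counts the vertices of kind `f` modulo `n`, and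
appends the gadget chosen for that number; some further numbers that come with the gadget are
written on `scr`. If there is no gadget, a flag is set on `buf` instead. -/
abbrev doubling (flip : Bool) (n : ℕ) [NeZero n] (Γ : ZMod n → Option (List Node × List ℕ)) :
    Parser where
  X := ZMod n
  finite := inferInstance
  init := 0
  label κ x := (if κ = .f then x + 1 else x, pushes .out (encodeNats [(κ.label flip : ℕ)]))
  bit _ _ := pushes .out [true, true]
  edge _ _ x _ := (x, pushes .out [false])
  close _ x := (x, [])
  final x :=
    match Γ x with
    | some G => pushes .out (encodeNats (tokens flip G.1)) ++ pushes .scr (encodeNats G.2)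
    | none => [.push .buf true]

section doubling

variable {flip : Bool} {n : ℕ} [NeZero n] {Γ : ZMod n → Option (List Node × List ℕ)}

theorem doubling_readEdges (κ : Kind) (j : ℕ) (es : List ℕ) (c : ZMod n × Work) :
    (doubling flip n Γ).readEdges κ j es c = (c.1, Function.update c.2 .out
      ((encodeNats (es.map (2 * ·))).reverse ++ c.2 .out)) := by
  have hbit : ∀ (e : ℕ) (c : ZMod n × Work), ((doubling flip n Γ).doBit κ)^[e] c =
      (c.1, Function.update c.2 .out (List.replicate (2 * e) true ++ c.2 .out)) := by
    intro e
    induction e with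
    | zero => intro c; simp
    | succ e ih =>
      intro c
      rw [Function.iterate_succ_apply']
      erw [ih]
      simp [Parser.doBit, doubling, mul_add, List.replicate_succ]
  induction es generalizing j c with
  | nil => simp [Parser.readEdges]
  | cons e es ih =>
    rw [Parser.readEdges, ih, Parser.readEdge]
    erw [hbit]
    simp [Parser.doEdge, doubling, encodeNats_cons]

theorem doubling_readNode (c : ZMod n × Work) (v : Node) :
    (doubling flip n Γ).readNode c v = (c.1 + if v.1 = .f then 1 else 0,
      Function.update c.2 .out
        ((encodeNats (nodeTokens flip (v.rename (2 * ·)))).reverse ++ c.2 .out)) := by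
  simp only [Parser.readNode]
  erw [doubling_readEdges]
  by_cases h : v.1 = .f <;>
  simp [Parser.doClose, Parser.doLabel, doubling, encodeNats_cons, nodeTokens, Node.rename, h]

theorem doubling_foldl (V : List Node) (c : ZMod n × Work) :
    V.foldl (doubling flip n Γ).readNode c = (c.1 + (V.countP (·.1 = .f) : ℕ),
      Function.update c.2 .out
        ((encodeNats (tokens flip (V.map (Node.rename (2 * ·))))).reverse ++ c.2 .out)) := by
  induction V generalizing c with
  | nil => simp [tokens]
  | cons v V ih =>
    rw [List.foldl_cons]
    erw [doubling_readNode, ih]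
    by_cases h : v.1 = .f <;>
    simp [tokens_cons, encodeNats_append, h]
    ring

theorem doubling_result_some (V : List Node) (G : List Node × List ℕ)
    (h : Γ (V.countP (·.1 = .f) : ℕ) = some G) :
    (doubling flip n Γ).result V (fun _ => []) = mkWork
      ((encodeNats (tokens flip (V.map (Node.rename (2 * ·)) ++ G.1))).reverse) [] [] []
      ((encodeNats G.2).reverse) := by
  simp only [Parser.result]
  erw [doubling_foldl]
  rw [Work.ext_iff]
  simp [h, tokens_append, encodeNats_append, runActs_append]

theorem doubling_result_none (V : List Node)
    (h : Γ (V.countP (·.1 = .f) : ℕ) = none) :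
    (doubling flip n Γ).result V (fun _ => []) .buf = [true] := by
  simp only [Parser.result]
  erw [doubling_foldl]
  simp [h, Act.run]

end doubling

/-! ### Splitting the unary vertices -/

/-- The parser that splits the edge `e` of every vertex of kind `w`: the old half is named `2 * e`,
the new one `2 * e + 1`, and the vertex becomes a straddled one with these edges. The new edges are
attached, in groups of `n`, to new vertices of kind `g`, which are collected in `aux` and counted
in `mem`. -/
abbrev splitting (flip : Bool) (n : ℕ) [NeZero n] : Parser where
  X := ZMod n
  finite := inferInstance
  init := 0
  label κ x :=
    (if κ = .w then x + 1 else x, pushes .out (encodeNats [(κ.label flip : ℕ)]) ++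
      if κ = .w ∧ x = 0 then
        pushes .aux (encodeNats [(Kind.label flip .g : ℕ)]) ++ pushes .mem [true] else [])
  bit κ _ := pushes .out [true, true] ++
    if κ = .w then pushes .buf [true, true] ++ pushes .aux [true, true] else []
  edge κ _ x _ := (x,
    if κ = .w then
      (if flip then pushes .out [false] ++ .move .buf .out :: pushes .out [true, false]
        else pushes .out [true, false] ++ .move .buf .out :: pushes .out [false]) ++
        pushes .aux [true, false]
    else pushes .out [false])
  close _ x := (x, [])
  final _ := []

/-- The vertex that replaces `v` when the edges of the vertices of kind `w` are split. -/
def splitNode (flip : Bool) (v : Node) : Node :=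
  (v.1, if v.1 = .w then
    v.2.flatMap fun e => if flip then [2 * e, 2 * e + 1] else [2 * e + 1, 2 * e]
    else v.2.map (2 * ·))

/-- The numbers that encode the new vertices for the new edges of `es`, beginning with a vertex that
has `x` edges already. -/
def groupTokens (flip : Bool) (n : ℕ) : ZMod n → List ℕ → List ℕ
  | _, [] => []
  | x, e :: es =>
    (if x = 0 then [(Kind.label flip .g : ℕ)] else []) ++
      (2 * e + 1) :: groupTokens flip n (x + 1) es

/-- The number of vertices begun in `groupTokens`. -/
def groupCount (n : ℕ) : ZMod n → List ℕ → ℕ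
  | _, [] => 0
  | x, _ :: es => (if x = 0 then 1 else 0) + groupCount n (x + 1) es

/-- The edges at the vertices of a given kind. -/
def ends (κ : Kind) (V : List Node) : List ℕ := V.flatMap fun v => if v.1 = κ then v.2 else []

theorem ends_cons (κ : Kind) (v : Node) (V : List Node) :
    ends κ (v :: V) = (if v.1 = κ then v.2 else []) ++ ends κ V := by
  simp [ends]

theorem ends_append (κ : Kind) (V W : List Node) : ends κ (V ++ W) = ends κ V ++ ends κ W := by
  simp [ends]

theorem groupTokens_append (flip : Bool) {n : ℕ} (x : ZMod n) (es es' : List ℕ) :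
    groupTokens flip n x (es ++ es') =
      groupTokens flip n x es ++ groupTokens flip n (x + es.length) es' := by
  induction es generalizing x with
  | nil => simp [groupTokens]
  | cons e es ih => simp [groupTokens, ih, add_assoc, add_comm (1 : ZMod n)]

theorem groupCount_append {n : ℕ} (x : ZMod n) (es es' : List ℕ) :
    groupCount n x (es ++ es') = groupCount n x es + groupCount n (x + es.length) es' := by
  induction es generalizing x with
  | nil => simp [groupCount]
  | cons e es ih => simp [groupCount, ih, add_assoc, add_comm (1 : ZMod n)]

section splitting

variable {flip : Bool} {n : ℕ} [NeZero n]

theorem splitting_readEdges {κ : Kind} (hκ : κ ≠ .w) (j : ℕ) (es : List ℕ)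
    (c : ZMod n × Work) : (splitting flip n).readEdges κ j es c = (c.1, Function.update c.2 .out
      ((encodeNats (es.map (2 * ·))).reverse ++ c.2 .out)) := by
  have hbit : ∀ (e : ℕ) (c : ZMod n × Work), ((splitting flip n).doBit κ)^[e] c =
      (c.1, Function.update c.2 .out (List.replicate (2 * e) true ++ c.2 .out)) := by
    intro e
    induction e with
    | zero => intro c; simp
    | succ e ih =>
      intro c
      rw [Function.iterate_succ_apply']
      erw [ih]
      simp [Parser.doBit, splitting, mul_add, List.replicate_succ, hκ]
  induction es generalizing j c with
  | nil => simp [Parser.readEdges]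
  | cons e es ih =>
    rw [Parser.readEdges, ih, Parser.readEdge]
    erw [hbit]
    simp [Parser.doEdge, splitting, encodeNats_cons, hκ]

theorem splitting_bits (e : ℕ) (c : ZMod n × Work) :
    ((splitting flip n).doBit .w)^[e] c = (c.1, mkWork (List.replicate (2 * e) true ++ c.2 .out)
      (List.replicate (2 * e) true ++ c.2 .aux) (List.replicate (2 * e) true ++ c.2 .buf)
      (c.2 .mem) (c.2 .scr)) := by
  induction e with
  | zero => exact Prod.ext rfl (Work.ext_iff.2 (by simp))
  | succ e ih =>
    rw [Function.iterate_succ_apply', ih]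
    refine Prod.ext rfl (Work.ext_iff.2 ?_)
    simp [Parser.doBit, splitting, runActs_append, mul_add, List.replicate_succ]

theorem splitting_readNode (v : Node) (hv : v.1 = .w → v.2.length = 1) (c : ZMod n × Work)
    (hc : c.2 .buf = []) :
    (splitting flip n).readNode c v = (c.1 + (ends .w [v]).length, mkWork
      ((encodeNats (nodeTokens flip (splitNode flip v))).reverse ++ c.2 .out)
      ((encodeNats (groupTokens flip n c.1 (ends .w [v]))).reverse ++ c.2 .aux) []
      (List.replicate (groupCount n c.1 (ends .w [v])) true ++ c.2 .mem) (c.2 .scr)) := by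
  obtain ⟨κ, es⟩ := v
  by_cases hκ : κ = .w
  · subst hκ
    obtain ⟨e, rfl⟩ := List.length_eq_one_iff.1 (hv rfl)
    simp only [Parser.readNode, Parser.readEdges, Parser.readEdge]
    erw [splitting_bits]
    refine Prod.ext ?_ (Work.ext_iff.2 ?_)
    · simp [Parser.doClose, Parser.doEdge, Parser.doLabel, splitting, ends]
    · by_cases hx : c.1 = 0 <;> cases flip <;>
      simp [Parser.doClose, Parser.doEdge, Parser.doLabel, splitting, ends, hx, runActs_append,
        Act.run, hc, nodeTokens, splitNode, groupTokens, groupCount, encodeNats_cons,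
        List.replicate_succ']
  · simp only [Parser.readNode]
    erw [splitting_readEdges hκ]
    refine Prod.ext ?_ (Work.ext_iff.2 ?_) <;>
    simp [Parser.doClose, Parser.doLabel, splitting, ends, hκ, hc, nodeTokens, splitNode,
      groupTokens, groupCount, encodeNats_cons]

theorem splitting_foldl (V : List Node) (hV : ∀ v ∈ V, v.1 = .w → v.2.length = 1)
    (c : ZMod n × Work) (hc : c.2 .buf = []) :
    V.foldl (splitting flip n).readNode c = (c.1 + (ends .w V).length, mkWork
      ((encodeNats (tokens flip (V.map (splitNode flip)))).reverse ++ c.2 .out)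
      ((encodeNats (groupTokens flip n c.1 (ends .w V))).reverse ++ c.2 .aux) []
      (List.replicate (groupCount n c.1 (ends .w V)) true ++ c.2 .mem) (c.2 .scr)) := by
  induction V generalizing c with
  | nil =>
    refine Prod.ext (by simp [ends]) (Work.ext_iff.2 ?_)
    simp [hc, tokens, ends, groupTokens, groupCount]
  | cons v V ih =>
    rw [List.foldl_cons, splitting_readNode v (hV v (by simp)) c hc]
    erw [ih (fun v hv => hV v (by simp [hv])) _ rfl]
    have h : ends .w (v :: V) = ends .w [v] ++ ends .w V := ends_append .w [v] V
    refine Prod.ext ?_ (Work.ext_iff.2 ?_)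
    · simp [h, add_assoc]
    · simp only [h, groupTokens_append, groupCount_append, tokens_cons, List.map_cons,
        encodeNats_append, List.reverse_append, List.append_assoc, true_and, and_true, mkWork_out,
        mkWork_aux, mkWork_buf, mkWork_mem, mkWork_scr, ← List.replicate_append_replicate]
      rw [← List.append_assoc, ← List.append_assoc, List.replicate_append_replicate,
        List.replicate_append_replicate, add_comm]

/-- If the number of edges is divisible by `n`, the groups are complete. -/
theorem exists_groups (K : ℕ) (es : List ℕ) (hes : es.length = n * K) :
    ∃ L : List (List ℕ), L.flatten = es ∧ (∀ l ∈ L, l.length = n) ∧ L.length = K ∧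
      groupTokens flip n 0 es = tokens flip (L.map fun l => (.g, l.map (2 * · + 1))) ∧
      groupCount n 0 es = K := by
  have hn := NeZero.pos n
  -- the rest of a group of which `j` edges have been read
  have key : ∀ (as : List ℕ) (j : ℕ), 0 < j → j + as.length = n →
      groupTokens flip n j as = as.map (2 * · + 1) ∧ groupCount n j as = 0 := by
    intro as
    induction as with
    | nil => intro j _ _; simp [groupTokens, groupCount]
    | cons e as ih =>
      intro j hj hjn
      rw [List.length_cons] at hjn
      have h0 : (j : ZMod n) ≠ 0 := by
        rw [Ne, ZMod.natCast_eq_zero_iff]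
        exact fun h => absurd (Nat.le_of_dvd hj h) (by omega)
      obtain ⟨h1, h2⟩ := ih (j + 1) (by omega) (by omega)
      push_cast at h1 h2
      simp [groupTokens, groupCount, h0, h1, h2]
  induction K generalizing es with
  | zero =>
    obtain rfl : es = [] := List.eq_nil_of_length_eq_zero (by simpa using hes)
    exact ⟨[], by simp [groupTokens, tokens, groupCount]⟩
  | succ K ih =>
    obtain ⟨e, as, has⟩ : ∃ e as, es.take n = e :: as := by
      refine List.exists_cons_of_ne_nil fun h => ?_
      have := congrArg List.length h
      rw [List.length_take, hes, List.length_nil, mul_add, mul_one] at this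
      omega
    have hlen : (es.take n).length = n := by
      rw [List.length_take, hes, mul_add, mul_one]; omega
    obtain ⟨L, hL, hLn, hLK, h1, h2⟩ := ih (es.drop n) (by
      rw [List.length_drop, hes, mul_add, mul_one]; omega)
    obtain ⟨k1, k2⟩ := key as 1 one_pos (by rw [← hlen, has, List.length_cons, add_comm])
    push_cast at k1 k2
    have h0 : (0 : ZMod n) + ((es.take n).length : ℕ) = 0 := by rw [hlen]; simp
    refine ⟨es.take n :: L, by simp [hL], ?_, by simp [hLK], ?_, ?_⟩
    · intro l hl
      rcases List.mem_cons.1 hl with rfl | hl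
      exacts [hlen, hLn l hl]
    · conv_lhs => rw [← List.take_append_drop n es]
      rw [groupTokens_append, h0, h1, List.map_cons, tokens_cons, has]
      simp [groupTokens, k1, nodeTokens]
    · conv_lhs => rw [← List.take_append_drop n es]
      rw [groupCount_append, h0, h2, has]
      simp [groupCount, k2, add_comm]

end splitting

/-! ### A bit vector indexed by edges -/

/-- The actions that move the head of a tape one cell to the right; the cells to the right of the
head are on the stack `mem`, those to its left on `scr`. Blank cells hold `false`. -/
def rightActs : Option Bool → List Act
  | some b => [.pop .mem, .push .scr b]
  | none => [.push .scr false]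

/-- The effect of a move to the right on the two halves of the tape. -/
def tapeRight : List Bool × List Bool → List Bool × List Bool
  | (l, []) => (false :: l, [])
  | (l, b :: r) => (b :: l, r)

theorem runActs_rightActs (u : Work) :
    runActs (rightActs (u .mem).head?) u = Function.update (Function.update u
      .scr (tapeRight (u .scr, u .mem)).1) .mem (tapeRight (u .scr, u .mem)).2 := by
  rcases h : u .mem with _ | ⟨b, r⟩ <;>
  simp [Work.ext_iff, rightActs, Act.run, h, tapeRight]

theorem tapeRight_iterate_length (e : ℕ) (c : List Bool × List Bool) :
    (tapeRight^[e] c).1.length = c.1.length + e := by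
  induction e generalizing c with
  | zero => rfl
  | succ e ih =>
    obtain ⟨l, _ | ⟨b, r⟩⟩ := c <;>
    · rw [Function.iterate_succ_apply, ih]
      simp only [tapeRight, List.length_cons]
      ring

/-- The cells of the tape are not changed by moving the head. -/
theorem tapeRight_iterate_getD (e : ℕ) (c : List Bool × List Bool) (i : ℕ) :
    ((tapeRight^[e] c).1.reverse ++ (tapeRight^[e] c).2).getD i false =
      (c.1.reverse ++ c.2).getD i false := by
  induction e generalizing c with
  | zero => rfl
  | succ e ih =>
    rw [Function.iterate_succ_apply, ih]
    obtain ⟨l, _ | ⟨b, r⟩⟩ := c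
    · simp only [tapeRight, List.reverse_cons, List.append_nil, List.getD_eq_getElem?_getD,
        List.getElem?_append, List.length_reverse]
      split_ifs with h
      · rfl
      · rw [List.getElem?_eq_none (l := l.reverse) (by simpa using h)]
        rcases i - l.length with _ | k <;> simp
    · simp [tapeRight]

/-- After `e` moves to the right, the head is at cell `e`. -/
theorem tapeRight_iterate_head (e : ℕ) (r : List Bool) :
    (tapeRight^[e] ([], r)).2.head? = some true ↔ r.getD e false = true := by
  have h := tapeRight_iterate_getD e ([], r) e
  have hl : (tapeRight^[e] ([], r)).1.reverse.length = e := by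
    simp [tapeRight_iterate_length]
  rw [List.getD_append_right _ _ _ _ (by rw [hl]), hl, Nat.sub_self] at h
  simp only [List.reverse_nil, List.nil_append] at h
  rw [← h]
  rcases (tapeRight^[e] ([], r)).2 with _ | ⟨b, _⟩ <;> simp

/-- The parser that copies the input to `out` and writes the characteristic bit vector of the set of
all edges at vertices of kind `w` on `mem`. It also writes the formula `1`, the empty
product, on `aux`. -/
abbrev marking (flip : Bool) : Parser where
  X := Unit
  finite := inferInstance
  init := ()
  label κ x := (x, pushes .out (encodeNats [(κ.label flip : ℕ)]))
  bit κ o := .push .out true :: if κ = .w then rightActs o else []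
  edge κ _ x o := (x, .push .out false ::
    if κ = .w then (if o.isSome then [.pop .mem] else []) ++ [.push .mem true, .move .scr .mem]
    else [])
  close _ x := (x, [])
  final _ := pushes .aux (encodeNats [1]).reverse

/-- `IsBitVector l A` says that `l` is the characteristic bit vector of the set of the elements of
the list `A`; bits beyond its end are `false`. -/
def IsBitVector (l : List Bool) (A : List ℕ) : Prop := ∀ i, l.getD i false = decide (i ∈ A)

section marking

variable {flip : Bool}

theorem marking_bits (κ : Kind) (e : ℕ) (c : Unit × Work) :
    ((marking flip).doBit κ)^[e] c = ((), mkWork (List.replicate e true ++ c.2 .out) (c.2 .aux)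
      (c.2 .buf) (if κ = .w then (tapeRight^[e] (c.2 .scr, c.2 .mem)).2 else c.2 .mem)
      (if κ = .w then (tapeRight^[e] (c.2 .scr, c.2 .mem)).1 else c.2 .scr)) := by
  induction e with
  | zero => exact Prod.ext rfl (Work.ext_iff.2 (by simp))
  | succ e ih =>
    rw [Function.iterate_succ_apply', ih]
    refine Prod.ext rfl (Work.ext_iff.2 ?_)
    by_cases hκ : κ = .w
    · have h := runActs_rightActs (Function.update (mkWork (List.replicate e true ++ c.2 .out)
        (c.2 .aux) (c.2 .buf) ((tapeRight^[e] (c.2 .scr, c.2 .mem)).2)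
        ((tapeRight^[e] (c.2 .scr, c.2 .mem)).1)) .out
          (true :: (List.replicate e true ++ c.2 .out)))
      simp only [Function.update_of_ne, ne_eq, reduceCtorEq, not_false_eq_true, mkWork_mem,
        mkWork_scr] at h
      simp [Parser.doBit, Act.run, hκ, h, List.replicate_succ, Function.iterate_succ_apply',
        -Function.iterate_succ]
    · simp [Parser.doBit, Act.run, hκ, List.replicate_succ]

theorem marking_readEdge (κ : Kind) (j e : ℕ) (c : Unit × Work) (A : List ℕ)
    (hs : c.2 .scr = []) (hm : IsBitVector (c.2 .mem) A) :
    ∃ l, IsBitVector l (if κ = .w then e :: A else A) ∧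
      (marking flip).readEdge κ j e c = ((), mkWork ((encodeNats [e]).reverse ++ c.2 .out)
        (c.2 .aux) (c.2 .buf) l []) := by
  rw [Parser.readEdge, marking_bits]
  by_cases hκ : κ = .w
  · subst hκ
    have hlen := tapeRight_iterate_length e (c.2 .scr, c.2 .mem)
    have hget := tapeRight_iterate_getD e (c.2 .scr, c.2 .mem)
    rw [hs] at hlen hget
    simp only [hs, if_true]
    set l := (tapeRight^[e] ([], c.2 .mem)).1
    set r := (tapeRight^[e] ([], c.2 .mem)).2
    simp only [List.length_nil, zero_add, List.reverse_nil, List.nil_append] at hlen hget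
    refine ⟨l.reverse ++ true :: r.tail, fun i => ?_, Prod.ext rfl (Work.ext_iff.2 ?_)⟩
    · have h := hget i
      rw [hm i] at h
      have hi : decide (i ∈ e :: A) = (decide (i = e) || decide (i ∈ A)) := by simp
      rw [hi, ← h]
      simp only [List.getD_eq_getElem?_getD, List.getElem?_append, List.length_reverse, hlen]
      rcases lt_trichotomy i e with h | h | h
      · simp [h, h.ne]
      · simp [h]
      · rw [if_neg h.not_gt, if_neg h.not_gt]
        obtain ⟨k, hk⟩ : ∃ k, i - e = k + 1 := ⟨i - e - 1, by omega⟩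
        simp [hk, h.ne']
    · rcases r with _ | ⟨b, r⟩ <;>
      simp [Parser.doEdge, Act.run, encodeNats_singleton]
  · refine ⟨c.2 .mem, by simpa [hκ] using hm, Prod.ext rfl (Work.ext_iff.2 ?_)⟩
    simp [Parser.doEdge, Act.run, encodeNats_singleton, hκ, hs]

theorem marking_readEdges (κ : Kind) (j : ℕ) (es : List ℕ) (c : Unit × Work) (A : List ℕ)
    (hs : c.2 .scr = []) (hm : IsBitVector (c.2 .mem) A) :
    ∃ l, IsBitVector l ((if κ = .w then es else []) ++ A) ∧
      (marking flip).readEdges κ j es c = ((), mkWork ((encodeNats es).reverse ++ c.2 .out)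
        (c.2 .aux) (c.2 .buf) l []) := by
  induction es generalizing j c A with
  | nil => exact ⟨c.2 .mem, by simpa using hm, Prod.ext rfl (Work.ext_iff.2 (by simp [hs,
      Parser.readEdges]))⟩
  | cons e es ih =>
    obtain ⟨l, hl, h⟩ := marking_readEdge (flip := flip) κ j e c A hs hm
    rw [Parser.readEdges, h]
    obtain ⟨l', hl', h'⟩ := ih (j + 1) ((), mkWork ((encodeNats [e]).reverse ++ c.2 .out)
        (c.2 .aux) (c.2 .buf) l []) _ rfl hl
    refine ⟨l', fun i => (hl' i).trans ?_, h'.trans (Prod.ext rfl (Work.ext_iff.2 ?_))⟩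
    · by_cases hκ : κ = .w <;> simp [hκ, or_left_comm]
    · simp [encodeNats_cons]

theorem marking_foldl (V : List Node) (c : Unit × Work) (A : List ℕ)
    (hs : c.2 .scr = []) (hm : IsBitVector (c.2 .mem) A) :
    ∃ l, IsBitVector l (ends .w V ++ A) ∧
      V.foldl (marking flip).readNode c = ((), mkWork
        ((encodeNats (tokens flip V)).reverse ++ c.2 .out) (c.2 .aux) (c.2 .buf) l []) := by
  induction V generalizing c A with
  | nil => exact ⟨c.2 .mem, by simpa [ends] using hm, Prod.ext rfl (Work.ext_iff.2 (by simp [hs,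
      tokens]))⟩
  | cons v V ih =>
    rw [List.foldl_cons]
    obtain ⟨l, hl, h⟩ := marking_readEdges (flip := flip) v.1 0 v.2
      ((marking flip).doLabel v.1 c) A (by simp [Parser.doLabel, hs])
      (by simpa [Parser.doLabel] using hm)
    have hnode : (marking flip).readNode c v = ((), mkWork
        ((encodeNats (nodeTokens flip v)).reverse ++ c.2 .out) (c.2 .aux) (c.2 .buf) l []) := by
      rw [Parser.readNode, h]
      refine Prod.ext rfl (Work.ext_iff.2 ?_)
      simp [Parser.doClose, Parser.doLabel, nodeTokens, encodeNats_cons]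
    rw [hnode]
    obtain ⟨l', hl', h'⟩ := ih ((), mkWork ((encodeNats (nodeTokens flip v)).reverse ++ c.2 .out)
        (c.2 .aux) (c.2 .buf) l []) _ rfl hl
    refine ⟨l', fun i => (hl' i).trans ?_, h'.trans (Prod.ext rfl (Work.ext_iff.2 ?_))⟩
    · by_cases hκ : v.1 = .w <;> simp [hκ, ends_cons, or_left_comm]
    · simp [tokens_cons, encodeNats_append]

theorem marking_result (V : List Node) :
    ∃ l, IsBitVector l (ends .w V) ∧
      (marking flip).result V (fun _ => []) = mkWork ((encodeNats (tokens flip V)).reverse)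
        (encodeNats [1]) [] l [] := by
  obtain ⟨l, hl, h⟩ := marking_foldl (flip := flip) V ((), fun _ => []) [] rfl
    (fun i => by simp)
  refine ⟨l, by simpa using hl, ?_⟩
  rw [Parser.result]
  erw [h]
  exact Work.ext_iff.2 (by simp)

end marking

/-! ### Writing down a product -/

/-- The parser that prepends to `aux`, for every vertex of kind `f`, the numbers `cf β`, where `β`
tells which of the `m` edges at the vertex are in the bit vector on `mem`, and for every vertex of
kind `g` the numbers `cg`. -/
abbrev collecting (m : ℕ) (cf : (Fin m → Bool) → List ℕ) (cg : List ℕ) : Parser where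
  X := Fin m → Bool
  finite := inferInstance
  init := fun _ => false
  label _ x := (x, [])
  bit κ o := if κ = .f then rightActs o else []
  edge κ j x o :=
    if κ = .f then (fun i => if (i : ℕ) = j then o == some true else x i, [.move .scr .mem])
    else (x, [])
  close κ x := (x,
    match κ with
    | .f => pushes .aux (encodeNats (cf x)).reverse
    | .g => pushes .aux (encodeNats cg).reverse
    | .w => [])
  final _ := [.move .aux .buf]

/-- The pattern of the edges of a vertex that are in `A`. -/
def pattern (m : ℕ) (A es : List ℕ) : Fin m → Bool := fun i => decide (es.getD i 0 ∈ A)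

/-- The numbers that `collecting` writes for a list of vertices. -/
def factorTokens {m : ℕ} (cf : (Fin m → Bool) → List ℕ) (cg : List ℕ) (A : List ℕ)
    (v : Node) : List ℕ :=
  match v.1 with
  | .f => cf (pattern m A v.2)
  | .g => cg
  | .w => []

section collecting

variable {m : ℕ} {cf : (Fin m → Bool) → List ℕ} {cg : List ℕ}

theorem collecting_bits (e : ℕ) (c : (Fin m → Bool) × Work) :
    ((collecting m cf cg).doBit .f)^[e] c = (c.1, mkWork (c.2 .out) (c.2 .aux) (c.2 .buf)
      ((tapeRight^[e] (c.2 .scr, c.2 .mem)).2) ((tapeRight^[e] (c.2 .scr, c.2 .mem)).1)) := by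
  induction e with
  | zero => exact Prod.ext rfl (Work.ext_iff.2 (by simp))
  | succ e ih =>
    rw [Function.iterate_succ_apply', ih]
    refine Prod.ext rfl (Work.ext_iff.2 ?_)
    have h := runActs_rightActs (mkWork (c.2 .out) (c.2 .aux) (c.2 .buf)
      ((tapeRight^[e] (c.2 .scr, c.2 .mem)).2) (tapeRight^[e] (c.2 .scr, c.2 .mem)).1)
    simp only [mkWork_mem, mkWork_scr] at h
    simp [Parser.doBit, h, Function.iterate_succ_apply', -Function.iterate_succ]

theorem collecting_readEdges_f (A : List ℕ) (j : ℕ) (es : List ℕ) (c : (Fin m → Bool) × Work)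
    (hs : c.2 .scr = []) (hm : IsBitVector (c.2 .mem) A) :
    ∃ l, IsBitVector l A ∧ (collecting m cf cg).readEdges .f j es c =
      (fun i : Fin m => if j ≤ (i : ℕ) ∧ (i : ℕ) < j + es.length then
          decide (es.getD ((i : ℕ) - j) 0 ∈ A) else c.1 i,
        Function.update c.2 .mem l) := by
  induction es generalizing j c with
  | nil =>
    refine ⟨c.2 .mem, hm, Prod.ext (funext fun i => ?_) (by simp [Parser.readEdges])⟩
    have h : ¬(j ≤ (i : ℕ) ∧ (i : ℕ) < j + ([] : List ℕ).length) := by simp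
    exact (if_neg h).symm
  | cons e es ih =>
    have hget := tapeRight_iterate_getD e ([], c.2 .mem)
    have hhead := tapeRight_iterate_head e (c.2 .mem)
    rw [hm e] at hhead
    set l := (tapeRight^[e] ([], c.2 .mem)).1
    set r := (tapeRight^[e] ([], c.2 .mem)).2
    have hnew : IsBitVector (l.reverse ++ r) A := fun i => (hget i).trans (by simpa using hm i)
    have hedge : (collecting m cf cg).readEdge .f j e c =
        (fun i : Fin m => if (i : ℕ) = j then decide (e ∈ A) else c.1 i,
          Function.update c.2 .mem (l.reverse ++ r)) := by
      rw [Parser.readEdge, collecting_bits, hs]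
      refine Prod.ext (funext fun i => ?_) (Work.ext_iff.2 ?_)
      · have : (r.head? == some true) = decide (e ∈ A) := by
          rw [Bool.eq_iff_iff, beq_iff_eq, hhead]
        simp only [Parser.doEdge, if_true, mkWork_mem]
        exact if_congr Iff.rfl this rfl
      · simp [Parser.doEdge, Act.run, hs, l, r]
    rw [Parser.readEdges, hedge]
    obtain ⟨l', hl', h'⟩ := ih (j + 1)
      (fun i : Fin m => if (i : ℕ) = j then decide (e ∈ A) else c.1 i,
        Function.update c.2 .mem (l.reverse ++ r)) (by simpa using hs) (by simpa using hnew)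
    refine ⟨l', hl', h'.trans (Prod.ext (funext fun i => ?_) (by simp))⟩
    simp only [List.length_cons]
    rcases lt_trichotomy (i : ℕ) j with h | h | h
    · rw [if_neg (by omega), if_neg (by omega), if_neg (by omega)]
    · rw [if_neg (by omega), if_pos h, if_pos (by omega)]
      simp [h]
    · obtain ⟨k, hk⟩ : ∃ k, (i : ℕ) = j + 1 + k := ⟨i - (j + 1), by omega⟩
      have e1 : (i : ℕ) - (j + 1) = k := by omega
      have e2 : (i : ℕ) - j = k + 1 := by omega
      rw [e1, e2, List.getD_cons_succ]
      by_cases hlt : (i : ℕ) < j + 1 + es.length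
      · rw [if_pos (by omega), if_pos (by omega)]
      · rw [if_neg (by omega), if_neg (by omega), if_neg (by omega)]

theorem collecting_readEdges {κ : Kind} (hκ : κ ≠ .f) (j : ℕ) (es : List ℕ)
    (c : (Fin m → Bool) × Work) : (collecting m cf cg).readEdges κ j es c = c := by
  have hbit : ∀ e, ((collecting m cf cg).doBit κ)^[e] c = c := by
    intro e
    induction e with
    | zero => rfl
    | succ e ih =>
      rw [Function.iterate_succ_apply', ih]
      simp [Parser.doBit, hκ]
  induction es generalizing j with
  | nil => rfl
  | cons e es ih =>
    rw [Parser.readEdges, Parser.readEdge, hbit]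
    have : (collecting m cf cg).doEdge κ j c = c := by simp [Parser.doEdge, hκ]
    rw [this, ih]

theorem collecting_foldl (A : List ℕ) (V : List Node) (hV : ∀ v ∈ V, v.1 = .f → v.2.length = m)
    (c : (Fin m → Bool) × Work) (hs : c.2 .scr = []) (hm : IsBitVector (c.2 .mem) A) :
    (V.foldl (collecting m cf cg).readNode c).2 .aux =
        V.foldl (fun l v => encodeNats (factorTokens cf cg A v) ++ l) (c.2 .aux) ∧
      (V.foldl (collecting m cf cg).readNode c).2 .buf = c.2 .buf := by
  induction V generalizing c with
  | nil => exact ⟨rfl, rfl⟩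
  | cons v V ih =>
    rw [List.foldl_cons, List.foldl_cons]
    obtain ⟨κ, es⟩ := v
    have hnode : ((collecting m cf cg).readNode c (κ, es)).2 .scr = [] ∧
        IsBitVector (((collecting m cf cg).readNode c (κ, es)).2 .mem) A ∧
        ((collecting m cf cg).readNode c (κ, es)).2 .buf = c.2 .buf ∧
        ((collecting m cf cg).readNode c (κ, es)).2 .aux =
          encodeNats (factorTokens cf cg A (κ, es)) ++ c.2 .aux := by
      simp only [Parser.readNode]
      by_cases hκ : κ = .f
      · subst hκ
        obtain ⟨l, hl, h⟩ := collecting_readEdges_f (cf := cf) (cg := cg) A 0 es c hs hm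
        have h0 : (collecting m cf cg).doLabel .f c = c := rfl
        have hp : (fun i : Fin m => if 0 ≤ (i : ℕ) ∧ (i : ℕ) < 0 + es.length then
            decide (es.getD (i - 0) 0 ∈ A) else c.1 i) = pattern m A es := by
          funext i
          have := hV (.f, es) (by simp) rfl
          dsimp only at this
          rw [if_pos ⟨Nat.zero_le _, by rw [this, zero_add]; exact i.isLt⟩]
          rfl
        rw [h0, h, hp]
        simp [Parser.doClose, factorTokens, hs, hl]
      · rw [collecting_readEdges hκ]
        cases κ <;> simp_all [Parser.doClose, Parser.doLabel, factorTokens]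
    obtain ⟨n1, n2, n3, n4⟩ := hnode
    obtain ⟨i1, i2⟩ := ih (fun v hv => hV v (by simp [hv])) _ n1 n2
    exact ⟨i1.trans (by rw [n4]), i2.trans n3⟩

end collecting

/-! ### Sums over 0-1 assignments -/

/-- The sum of `Φ` over all 0-1 assignments that vanish outside `E`. -/
noncomputable def sumBits (E : Finset ℕ) (Φ : (ℕ → Bool) → ℝ) : ℝ :=
  ∑ T ∈ E.powerset, Φ fun e => decide (e ∈ T)

theorem sumBits_congr (E : Finset ℕ) {Φ Ψ : (ℕ → Bool) → ℝ} (h : ∀ p, Φ p = Ψ p) :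
    sumBits E Φ = sumBits E Ψ :=
  Finset.sum_congr rfl fun _ _ => h _

theorem sumBits_const_mul (E : Finset ℕ) (c : ℝ) (Φ : (ℕ → Bool) → ℝ) :
    sumBits E (fun p => c * Φ p) = c * sumBits E Φ :=
  (Finset.mul_sum _ _ _).symm

theorem sumBits_image {E : Finset ℕ} {φ : ℕ → ℕ} (hφ : Set.InjOn φ E) {Ψ : (ℕ → Bool) → ℝ}
    (hΨ : DependsOn Ψ (E : Set ℕ)) :
    sumBits (E.image φ) (fun p => Ψ (p ∘ φ)) = sumBits E Ψ := by
  symm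
  refine Finset.sum_bij (fun T _ => T.image φ) ?_ ?_ ?_ ?_
  · intro T hT
    exact Finset.mem_powerset.2 (Finset.image_subset_image (Finset.mem_powerset.1 hT))
  · intro T hT T' hT' h
    refine Finset.coe_injective ((hφ.image_eq_image_iff (Finset.mem_powerset.1 hT)
      (Finset.mem_powerset.1 hT')).1 ?_)
    exact_mod_cast h
  · intro T hT
    obtain ⟨T', hT', rfl⟩ := Finset.subset_image_iff.1 (Finset.mem_powerset.1 hT)
    exact ⟨T', Finset.mem_powerset.2 hT', rfl⟩
  · intro T hT
    refine hΨ fun e he => ?_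
    simp only [Function.comp_apply, decide_eq_decide]
    exact ⟨fun h => Finset.mem_image_of_mem φ h, fun h => by
      obtain ⟨e', he', h'⟩ := Finset.mem_image.1 h
      rwa [← hφ (Finset.mem_powerset.1 hT he') he h']⟩

theorem sumBits_union {A B : Finset ℕ} (hAB : Disjoint A B) {Φ Ψ : (ℕ → Bool) → ℝ}
    (hΦ : DependsOn Φ (A : Set ℕ)) (hΨ : DependsOn Ψ (B : Set ℕ)) :
    sumBits (A ∪ B) (fun p => Φ p * Ψ p) = sumBits A Φ * sumBits B Ψ := by
  rw [sumBits, sumBits, sumBits, Finset.sum_mul_sum, ← Finset.sum_product']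
  symm
  refine Finset.sum_bij' (fun P _ => P.1 ∪ P.2) (fun T _ => (T ∩ A, T ∩ B)) ?_ ?_ ?_ ?_ ?_
  · rintro ⟨X, Y⟩ h
    simp only [Finset.mem_product, Finset.mem_powerset] at h ⊢
    exact Finset.union_subset_union h.1 h.2
  · intro T _
    simp [Finset.inter_subset_right]
  · rintro ⟨X, Y⟩ h
    simp only [Finset.mem_product, Finset.mem_powerset] at h
    ext e
    · have h1 := @h.1 e
      have h2 := @h.2 e
      have h3 : e ∈ A → e ∉ B := fun hA => Finset.disjoint_left.1 hAB hA
      simp only [Finset.mem_inter, Finset.mem_union]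
      tauto
    · have h1 := @h.1 e
      have h2 := @h.2 e
      have h3 : e ∈ A → e ∉ B := fun hA => Finset.disjoint_left.1 hAB hA
      simp only [Finset.mem_inter, Finset.mem_union]
      tauto
  · intro T hT
    rw [← Finset.inter_union_distrib_left]
    exact Finset.inter_eq_left.2 (Finset.mem_powerset.1 hT)
  · rintro ⟨X, Y⟩ h
    simp only [Finset.mem_product, Finset.mem_powerset] at h
    congr 1
    · refine hΦ fun e he => ?_
      have : e ∉ Y := fun hY => Finset.disjoint_left.1 hAB he (h.2 hY)
      simp [this]
    · refine hΨ fun e he => ?_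
      have : e ∉ X := fun hX => Finset.disjoint_left.1 hAB (h.1 hX) he
      simp [this]

theorem dependsOn_list_prod {ι : Type*} {s : Set ℕ} (L : List ι) (φ : ι → (ℕ → Bool) → ℝ)
    (h : ∀ i ∈ L, DependsOn (φ i) s) : DependsOn (fun p => (L.map fun i => φ i p).prod) s :=
  fun _ _ hpq => congrArg List.prod (List.map_congr_left fun i hi => h i hi hpq)

theorem dependsOn_list_map {s : Set ℕ} (es : List ℕ) (hes : ∀ e ∈ es, e ∈ s)
    (Ψ : List Bool → ℝ) : DependsOn (fun p : ℕ → Bool => Ψ (es.map p)) s :=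
  fun _ _ h => congrArg Ψ (List.map_congr_left fun e he => h e (hes e he))

/-- A sum over the assignments of a disjoint union of lists of edges factorizes. -/
theorem sumBits_flatMap {ι : Type*} (L : List ι) (es : ι → List ℕ) (φ : ι → (ℕ → Bool) → ℝ)
    (hL : (L.flatMap es).Nodup) (hφ : ∀ i ∈ L, DependsOn (φ i) ((es i).toFinset : Set ℕ)) :
    sumBits (L.flatMap es).toFinset (fun p => (L.map fun i => φ i p).prod) =
      (L.map fun i => sumBits (es i).toFinset (φ i)).prod := by
  induction L with
  | nil => simp [sumBits]
  | cons i L ih =>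
    rw [List.flatMap_cons, List.nodup_append'] at hL
    obtain ⟨_, h2, h3⟩ := hL
    rw [List.flatMap_cons, List.toFinset_append, List.map_cons, List.prod_cons,
      ← ih h2 fun j hj => hφ j (by simp [hj]), ← sumBits_union]
    · rfl
    · exact List.disjoint_toFinset_iff_disjoint.2 h3
    · exact hφ i (by simp)
    · refine dependsOn_list_prod L φ fun j hj => (hφ j (by simp [hj])).mono ?_
      intro e he
      have he' : e ∈ es j := by simpa using he
      simpa using ⟨j, hj, he'⟩

/-- A sum over the assignments of distinct edges depends only on their number. -/
theorem sumBits_toFinset {es : List ℕ} (hes : es.Nodup) (Ψ : List Bool → ℝ) :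
    sumBits es.toFinset (fun p => Ψ (es.map p)) =
      sumBits (Finset.range es.length) (fun q => Ψ ((List.range es.length).map q)) := by
  have hmap : ∀ p : ℕ → Bool, es.map p =
      (List.range es.length).map (p ∘ fun i => es.getD i 0) := by
    intro p
    refine List.ext_getElem (by simp) fun i h1 h2 => ?_
    have h : i < es.length := by simpa using h1
    simp [h]
  have himg : es.toFinset = (Finset.range es.length).image fun i => es.getD i 0 := by
    ext e
    simp only [List.mem_toFinset, Finset.mem_image, Finset.mem_range, List.mem_iff_getElem]
    constructor
    · rintro ⟨i, hi, rfl⟩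
      exact ⟨i, hi, by simp [hi]⟩
    · rintro ⟨i, hi, rfl⟩
      exact ⟨i, hi, by simp [hi]⟩
  rw [himg, sumBits_congr _ (fun p => congrArg Ψ (hmap p))]
  refine sumBits_image (Ψ := fun q => Ψ ((List.range es.length).map q)) ?_ ?_
  · intro i hi j hj hij
    have hi' : i < es.length := by simpa using hi
    have hj' : j < es.length := by simpa using hj
    exact (List.Nodup.getElem_inj_iff hes).1 (by simpa [hi', hj'] using hij)
  · exact dependsOn_list_map _ (by simp) Ψ

theorem sumBits_mem {K : Subfield ℝ} (E : Finset ℕ) {Φ : (ℕ → Bool) → ℝ} (h : ∀ p, Φ p ∈ K) :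
    sumBits E Φ ∈ K :=
  Subfield.sum_mem _ fun _ _ => h _

/-! ### Grids as lists of vertices -/

/-- The product of the values of all vertices under an assignment of the edges. -/
def nodeProd (val : Kind → List Bool → ℝ) (V : List Node) (p : ℕ → Bool) : ℝ :=
  (V.map fun v => val v.1 (v.2.map p)).prod

theorem nodeProd_append (val : Kind → List Bool → ℝ) (V W : List Node) (p : ℕ → Bool) :
    nodeProd val (V ++ W) p = nodeProd val V p * nodeProd val W p := by
  simp [nodeProd]

theorem nodeProd_rename (val : Kind → List Bool → ℝ) (V : List Node) (φ : ℕ → ℕ) (p : ℕ → Bool) :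
    nodeProd val (V.map (Node.rename φ)) p = nodeProd val V (p ∘ φ) := by
  simp [nodeProd, Node.rename, Function.comp_def]

/-- The lists of vertices that form a grid with the arities `ar`: every edge joins a vertex of kind
`f` to one of the other kinds. -/
structure IsGrid (ar : Kind → ℕ) (V : List Node) : Prop where
  length : ∀ v ∈ V, v.2.length = ar v.1
  nodup : (ends .f V).Nodup
  perm : (ends .f V).Perm (ends .g V ++ ends .w V)

/-- The Holant value of a grid. -/
noncomputable def gridValue (val : Kind → List Bool → ℝ) (V : List Node) : ℝ :=
  sumBits (ends .f V).toFinset (nodeProd val V)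

theorem ends_rename (κ : Kind) (φ : ℕ → ℕ) (V : List Node) :
    ends κ (V.map (Node.rename φ)) = (ends κ V).map φ := by
  induction V with
  | nil => rfl
  | cons v V ih =>
    rw [List.map_cons, ends_cons, ih, ends_cons, List.map_append]
    by_cases h : v.1 = κ <;> simp [Node.rename, h]

theorem mem_ends_of_mem {V : List Node} {v : Node} (hv : v ∈ V) {e : ℕ} (he : e ∈ v.2) :
    e ∈ ends v.1 V :=
  List.mem_flatMap.2 ⟨v, hv, by simpa using he⟩

namespace IsGrid

variable {ar : Kind → ℕ} {V W : List Node}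

theorem mem_ends (h : IsGrid ar V) {v : Node} (hv : v ∈ V) {e : ℕ} (he : e ∈ v.2) :
    e ∈ ends .f V := by
  have h' := mem_ends_of_mem hv he
  rcases hκ : v.1 with _ | _ | _ <;> rw [hκ] at h'
  · exact h'
  · exact h.perm.mem_iff.2 (by simp [h'])
  · exact h.perm.mem_iff.2 (by simp [h'])

theorem dependsOn_nodeProd (h : IsGrid ar V) (val : Kind → List Bool → ℝ) :
    DependsOn (nodeProd val V) ((ends .f V).toFinset : Set ℕ) :=
  dependsOn_list_prod V (fun v p => val v.1 (v.2.map p)) fun v hv =>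
    dependsOn_list_map v.2 (fun _ he => by simpa using h.mem_ends hv he) _

theorem length_ends (hV : ∀ v ∈ V, v.2.length = ar v.1) (κ : Kind) :
    (ends κ V).length = V.countP (·.1 = κ) * ar κ := by
  induction V with
  | nil => simp [ends]
  | cons v V ih =>
    rw [ends_cons, List.length_append, ih fun v hv => hV v (by simp [hv]), List.countP_cons]
    have := hV v (by simp)
    by_cases hκ : v.1 = κ
    · subst hκ
      simp [this]
      ring
    · simp [hκ]

theorem double_disjoint (l l' : List ℕ) :
    List.Disjoint (l.map (2 * ·)) (l'.map (2 * · + 1)) := by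
  intro e h h'
  obtain ⟨a, _, rfl⟩ := List.mem_map.1 h
  obtain ⟨b, _, hb⟩ := List.mem_map.1 h'
  omega

theorem double_injective : Function.Injective fun e : ℕ => 2 * e := fun a b h => by
  dsimp only at h; omega

theorem double_add_one_injective : Function.Injective fun e : ℕ => 2 * e + 1 := fun a b h => by
  dsimp only at h; omega

/-- The disjoint union of two grids; its edges are made distinct by parity. -/
theorem union (hV : IsGrid ar V) (hW : IsGrid ar W) :
    IsGrid ar (V.map (Node.rename (2 * ·)) ++ W.map (Node.rename (2 * · + 1))) where
  length v hv := by
    rcases List.mem_append.1 hv with hv | hv <;>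
    · obtain ⟨v', hv', rfl⟩ := List.mem_map.1 hv
      first
      | simpa [Node.rename] using hV.length v' hv'
      | simpa [Node.rename] using hW.length v' hv'
  nodup := by
    rw [ends_append, ends_rename, ends_rename]
    exact (hV.nodup.map double_injective).append (hW.nodup.map double_add_one_injective)
      (double_disjoint _ _)
  perm := by
    simp only [ends_append, ends_rename]
    refine ((hV.perm.map _).append (hW.perm.map _)).trans ?_
    simp only [List.map_append]
    rw [List.append_assoc, List.append_assoc]
    refine List.Perm.append_left _ ?_
    rw [← List.append_assoc, ← List.append_assoc]
    exact List.Perm.append_right _ List.perm_append_comm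

theorem sumBits_double (A B : List ℕ) {Φ Ψ : (ℕ → Bool) → ℝ}
    (hΦ : DependsOn Φ (A.toFinset : Set ℕ)) (hΨ : DependsOn Ψ (B.toFinset : Set ℕ)) :
    sumBits (A.map (2 * ·) ++ B.map (2 * · + 1)).toFinset
      (fun p => Φ (p ∘ (2 * ·)) * Ψ (p ∘ (2 * · + 1))) =
      sumBits A.toFinset Φ * sumBits B.toFinset Ψ := by
  have hcomp : ∀ {Φ : (ℕ → Bool) → ℝ} {A : List ℕ} (φ : ℕ → ℕ),
      DependsOn Φ (A.toFinset : Set ℕ) →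
      DependsOn (fun p : ℕ → Bool => Φ (p ∘ φ)) ((A.map φ).toFinset : Set ℕ) := by
    intro Φ A φ h p q hpq
    refine h fun e he => hpq (φ e) ?_
    have he' : e ∈ A := by simpa using he
    simpa using ⟨e, he', rfl⟩
  have himg : ∀ (A : List ℕ) (φ : ℕ → ℕ), (A.map φ).toFinset = A.toFinset.image φ := by
    intro A φ
    ext e
    simp
  rw [List.toFinset_append, sumBits_union _ (hcomp _ hΦ) (hcomp _ hΨ), himg, himg,
    sumBits_image double_injective.injOn hΦ, sumBits_image double_add_one_injective.injOn hΨ]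
  exact List.disjoint_toFinset_iff_disjoint.2 (double_disjoint _ _)

theorem gridValue_union (val : Kind → List Bool → ℝ) (hV : IsGrid ar V) (hW : IsGrid ar W) :
    gridValue val (V.map (Node.rename (2 * ·)) ++ W.map (Node.rename (2 * · + 1))) =
      gridValue val V * gridValue val W := by
  rw [gridValue, ends_append, ends_rename, ends_rename, gridValue, gridValue,
    ← sumBits_double _ _ (hV.dependsOn_nodeProd val) (hW.dependsOn_nodeProd val)]
  refine sumBits_congr _ fun p => ?_
  rw [nodeProd_append, nodeProd_rename, nodeProd_rename]

theorem exists_power (val : Kind → List Bool → ℝ) (hV : IsGrid ar V) (k : ℕ) :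
    ∃ W, IsGrid ar W ∧ gridValue val W = gridValue val V ^ k ∧
      W.countP (·.1 = .f) = k * V.countP (·.1 = .f) := by
  induction k with
  | zero =>
    refine ⟨[], ⟨by simp, by simp [ends], by simp [ends]⟩, ?_, by simp⟩
    simp [gridValue, sumBits, nodeProd, ends]
  | succ k ih =>
    obtain ⟨W, hW, h1, h2⟩ := ih
    refine ⟨_, hW.union hV, ?_, ?_⟩
    · rw [gridValue_union val hW hV, h1, pow_succ]
    · rw [List.countP_append, List.countP_map, List.countP_map, add_mul, one_mul, ← h2]
      rfl

/-- A grid with a nonzero value can be completed: there is another one with a nonzero value such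
that the total number of vertices of kind `f` is divisible by `n`, namely `n - 1` copies of the
grid. -/
theorem exists_complement (val : Kind → List Bool → ℝ) (hV : IsGrid ar V)
    (h : gridValue val V ≠ 0) (n : ℕ) [NeZero n] :
    ∃ W, IsGrid ar W ∧ gridValue val W ≠ 0 ∧
      ((V.countP (·.1 = .f) : ℕ) : ZMod n) + (W.countP (·.1 = .f) : ℕ) = 0 := by
  obtain ⟨W, hW, h1, h2⟩ := hV.exists_power val (n - 1)
  refine ⟨W, hW, by rw [h1]; exact pow_ne_zero _ h, ?_⟩
  rw [h2, Nat.cast_mul, Nat.cast_sub NeZero.one_le]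
  simp

/-- If the number of vertices of kind `f` is divisible by the arity of those of kind `g`, then so
is the number of edges at vertices of kind `w`. -/
theorem dvd_length_ends (hV : IsGrid ar V) (h : ar .g ∣ V.countP (·.1 = .f)) :
    ar .g ∣ (ends .w V).length := by
  have h1 := hV.perm.length_eq
  rw [List.length_append, length_ends hV.length .f, length_ends hV.length .g] at h1
  exact (Nat.dvd_add_right (Dvd.intro_left _ rfl)).1 (h1 ▸ h.mul_right _)

end IsGrid

/-! ### The value of a grid after splitting -/

/-- The signatures of the three kinds of vertices, given by functions of lists of bits. -/
def kindVal (F G : List Bool → ℝ) (wt : Bool → ℝ) : Kind → List Bool → ℝ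
  | .f => F
  | .g => G
  | .w => fun bs => wt (bs.getD 0 false)

/-- The signatures after splitting: the vertices of kind `w` carry the product of `wt` on the old
half of the edge and `u` on the new half. -/
def splitVal (flip : Bool) (F G : List Bool → ℝ) (u wt : Bool → ℝ) : Kind → List Bool → ℝ
  | .f => F
  | .g => G
  | .w => fun bs => u (bs.getD (if flip then 1 else 0) false) *
      wt (bs.getD (if flip then 0 else 1) false)

/-- The edges at the variables on the side of the vertices of kind `f`, when the vertices of kind
`w` are straddled. -/
def nearEnds (flip : Bool) (V : List Node) : List ℕ :=
  V.flatMap fun v => match v.1 with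
    | .f => v.2
    | .g => []
    | .w => [v.2.getD (if flip then 1 else 0) 0]

/-- The edges at the variables on the side of the vertices of kind `g`, when the vertices of kind
`w` are straddled. -/
def farEnds (flip : Bool) (V : List Node) : List ℕ :=
  V.flatMap fun v => match v.1 with
    | .f => []
    | .g => v.2
    | .w => [v.2.getD (if flip then 0 else 1) 0]

/-- The grid in which all edges at vertices of kind `w` are split, and the new edges are attached
to new vertices of kind `g` according to the list `L` of groups. -/
def splitGrid (flip : Bool) (V : List Node) (L : List (List ℕ)) : List Node :=
  V.map (splitNode flip) ++ L.map fun l => (.g, l.map (2 * · + 1))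

section split

variable {flip : Bool} {ar : Kind → ℕ} {V : List Node} {L : List (List ℕ)}

theorem length_of_mem_splitGrid (hw : ar .w = 1) (hV : ∀ v ∈ V, v.2.length = ar v.1)
    (hL : ∀ l ∈ L, l.length = ar .g) :
    ∀ v ∈ splitGrid flip V L, v.2.length = if v.1 = .w then 2 else ar v.1 := by
  intro v hv
  rcases List.mem_append.1 hv with hv | hv
  · obtain ⟨⟨κ, es⟩, hv', rfl⟩ := List.mem_map.1 hv
    have h := hV _ hv'
    by_cases hκ : κ = .w
    · subst hκ
      obtain ⟨e, he⟩ := List.length_eq_one_iff.1 (h.trans hw)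
      dsimp only at he
      subst he
      cases flip <;> simp [splitNode]
    · simpa [splitNode, hκ] using h
  · obtain ⟨l, hl, rfl⟩ := List.mem_map.1 hv
    simpa using hL l hl

theorem nearEnds_splitGrid (hw : ∀ v ∈ V, v.1 = .w → v.2.length = 1) :
    (nearEnds flip (splitGrid flip V L)).Perm
      ((ends .f V).map (2 * ·) ++ (ends .w V).map (2 * · + 1)) := by
  have h1 : nearEnds flip (splitGrid flip V L) = nearEnds flip (V.map (splitNode flip)) := by
    simp [nearEnds, splitGrid, List.flatMap_map]
  rw [h1]
  clear h1
  induction V with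
  | nil => simp [nearEnds, ends]
  | cons v V ih =>
    have ih' := List.perm_iff_count.1 (ih fun v hv => hw v (by simp [hv]))
    obtain ⟨κ, es⟩ := v
    rw [List.perm_iff_count]
    intro a
    have := ih' a
    rcases κ with _ | _ | _
    · simp [nearEnds, ends_cons, splitNode] at this ⊢
      omega
    · simp [nearEnds, ends_cons, splitNode] at this ⊢
      omega
    · obtain ⟨e, rfl⟩ := List.length_eq_one_iff.1 (hw (.w, es) (by simp) rfl)
      cases flip <;>
      · simp [nearEnds, ends_cons, splitNode, List.count_cons] at this ⊢
        omega

theorem farEnds_splitGrid (hw : ∀ v ∈ V, v.1 = .w → v.2.length = 1) :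
    (farEnds flip (splitGrid flip V L)).Perm
      ((ends .g V ++ ends .w V).map (2 * ·) ++ L.flatten.map (2 * · + 1)) := by
  have h1 : farEnds flip (splitGrid flip V L) =
      farEnds flip (V.map (splitNode flip)) ++ L.flatten.map (2 * · + 1) := by
    simp [farEnds, splitGrid, List.map_flatten, List.flatMap_def]
    rfl
  rw [h1]
  refine List.Perm.append_right _ ?_
  clear h1
  induction V with
  | nil => simp [farEnds, ends]
  | cons v V ih =>
    have ih' := List.perm_iff_count.1 (ih fun v hv => hw v (by simp [hv]))
    obtain ⟨κ, es⟩ := v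
    rw [List.perm_iff_count]
    intro a
    have := ih' a
    rcases κ with _ | _ | _
    · simp [farEnds, ends_cons, splitNode] at this ⊢
      omega
    · simp [farEnds, ends_cons, splitNode] at this ⊢
      omega
    · obtain ⟨e, rfl⟩ := List.length_eq_one_iff.1 (hw (.w, es) (by simp) rfl)
      cases flip <;>
      · simp [farEnds, ends_cons, splitNode, List.count_cons] at this ⊢
        omega

theorem nodeProd_splitNode (F G : List Bool → ℝ) (u wt : Bool → ℝ)
    (hw : ∀ v ∈ V, v.1 = .w → v.2.length = 1) (p : ℕ → Bool) :
    nodeProd (splitVal flip F G u wt) (V.map (splitNode flip)) p =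
      nodeProd (kindVal F G wt) V (p ∘ (2 * ·)) *
        ((ends .w V).map fun e => u (p (2 * e + 1))).prod := by
  induction V with
  | nil => simp [nodeProd, ends]
  | cons v V ih =>
    have ih' := ih fun v hv => hw v (by simp [hv])
    obtain ⟨κ, es⟩ := v
    simp only [nodeProd, List.map_cons, List.prod_cons, ends_cons, List.map_append,
      List.prod_append] at ih' ⊢
    rw [ih']
    rcases κ with _ | _ | _
    · simp [splitVal, kindVal, splitNode, Function.comp_def, mul_assoc]
    · simp [splitVal, kindVal, splitNode, Function.comp_def, mul_assoc]
    · obtain ⟨e, rfl⟩ := List.length_eq_one_iff.1 (hw (.w, es) (by simp) rfl)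
      cases flip <;>
      · simp [splitVal, kindVal, splitNode]
        ring

/-- The value of the signature `G` with all its variables weighted by `u`. -/
noncomputable def contraction (n : ℕ) (G : List Bool → ℝ) (u : Bool → ℝ) : ℝ :=
  sumBits (Finset.range n) fun q =>
    (((List.range n).map q).map u).prod * G ((List.range n).map q)

/-- Splitting the vertices of kind `w` multiplies the value by a contraction of `G` for every
new vertex. -/
theorem sumBits_splitGrid (F G : List Bool → ℝ) (u wt : Bool → ℝ) (hV : IsGrid ar V)
    (hw : ar .w = 1) (hL : L.flatten = ends .w V) (hLn : ∀ l ∈ L, l.length = ar .g) :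
    sumBits (nearEnds flip (splitGrid flip V L)).toFinset
      (nodeProd (splitVal flip F G u wt) (splitGrid flip V L)) =
      gridValue (kindVal F G wt) V * contraction (ar .g) G u ^ L.length := by
  have hw' : ∀ v ∈ V, v.1 = .w → v.2.length = 1 := fun v hv h => by
    rw [hV.length v hv, h, hw]
  have hnd : (ends .w V).Nodup :=
    (List.nodup_append'.1 (hV.perm.nodup_iff.1 hV.nodup)).2.1
  have hprod : ∀ p, nodeProd (splitVal flip F G u wt) (splitGrid flip V L) p =
      nodeProd (kindVal F G wt) V (p ∘ (2 * ·)) * (fun q : ℕ → Bool =>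
        (L.map fun l => ((l.map q).map u).prod * G (l.map q)).prod) (p ∘ (2 * · + 1)) := by
    intro p
    rw [splitGrid, nodeProd_append, nodeProd_splitNode F G u wt hw', ← hL, mul_assoc]
    congr 1
    have : nodeProd (splitVal flip F G u wt) (L.map fun l => (Kind.g, l.map (2 * · + 1))) p =
        (L.map fun l => G (l.map (p ∘ (2 * · + 1)))).prod := by
      simp [nodeProd, splitVal, Function.comp_def]
    rw [this]
    dsimp only
    rw [List.prod_map_mul]
    congr 1
    simp [List.map_flatten, List.prod_flatten, Function.comp_def]
  have hdep : ∀ l : List ℕ, DependsOn (fun q : ℕ → Bool =>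
      ((l.map q).map u).prod * G (l.map q)) (l.toFinset : Set ℕ) := fun l =>
    dependsOn_list_map l (fun _ he => by simpa using he) fun bs => (bs.map u).prod * G bs
  rw [List.toFinset_eq_of_perm _ _ (nearEnds_splitGrid hw'), sumBits_congr _ hprod,
    gridValue]
  refine (IsGrid.sumBits_double (ends .f V) (ends .w V) (Ψ := fun q : ℕ → Bool =>
    (L.map fun l => ((l.map q).map u).prod * G (l.map q)).prod)
    (hV.dependsOn_nodeProd (kindVal F G wt)) ?_).trans ?_
  · refine dependsOn_list_prod L _ fun l hl => (hdep l).mono fun e he => ?_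
    have he' : e ∈ l := by simpa using he
    simpa [← hL] using ⟨l, hl, he'⟩
  · congr 1
    rw [← hL] at hnd ⊢
    rw [← List.flatMap_id'] at hnd ⊢
    rw [sumBits_flatMap L (fun l => l) _ hnd fun l _ => hdep l]
    rw [List.map_congr_left (g := fun _ => contraction (ar .g) G u)]
    · simp
    · intro l hl
      have hl' : l.Nodup := (List.nodup_flatMap.1 hnd).1 l hl
      rw [sumBits_toFinset hl' fun bs => (bs.map u).prod * G bs, hLn l hl]
      rfl

theorem contraction_ne_zero {n : ℕ} {G : List Bool → ℝ} {u : Bool → ℝ} (hG : ∀ bs, 0 ≤ G bs)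
    (hu : ∀ b, 0 ≤ u b) (p : ℕ → Bool) (hGp : G ((List.range n).map p) ≠ 0)
    (hup : ∀ i < n, u (p i) ≠ 0) : contraction n G u ≠ 0 := by
  have hterm : ∀ q : ℕ → Bool,
      0 ≤ (((List.range n).map q).map u).prod * G ((List.range n).map q) := fun q =>
    mul_nonneg (List.prod_nonneg fun a ha => by
      obtain ⟨b, _, rfl⟩ := List.mem_map.1 ha
      exact hu b) (hG _)
  refine (Finset.sum_pos' (fun _ _ => hterm _)
    ⟨(Finset.range n).filter (p · = true), Finset.mem_powerset.2 (Finset.filter_subset _ _),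
      ?_⟩).ne'
  have : (List.range n).map (fun e => decide (e ∈ (Finset.range n).filter (p · = true))) =
      (List.range n).map p := by
    refine List.map_congr_left fun i hi => ?_
    simp [List.mem_range.1 hi]
  refine lt_of_le_of_ne (hterm _) (Ne.symm ?_)
  rw [this]
  refine mul_ne_zero (List.prod_ne_zero fun h => ?_) hGp
  obtain ⟨b, hb, h⟩ := List.mem_map.1 h
  obtain ⟨i, hi, rfl⟩ := List.mem_map.1 hb
  exact hup i (List.mem_range.1 hi) h

end split

/-! ### The value of a grid in which one signature pins its variables to one -/

/-- The weight of an edge: `wt` at the vertices of kind `w`, and the pinning `[0, 1]` at those of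
kind `g`. -/
def edgeWeight (wt : Bool → ℝ) (isW : Bool) (b : Bool) : ℝ :=
  if isW then wt b else if b then 1 else 0

/-- The value that the signature `F` contributes if its variables are weighted as given by `β`. -/
noncomputable def pinned (m : ℕ) (F : List Bool → ℝ) (wt : Bool → ℝ) (β : Fin m → Bool) : ℝ :=
  sumBits (Finset.range m) fun q => (fun bs : List Bool =>
    F bs * ∏ i : Fin m, edgeWeight wt (β i) (bs.getD i false)) ((List.range m).map q)

/-- The factor that a vertex contributes if `g` is a multiple of `[0, 1]^{⊗ n}`. -/
noncomputable def factor (m : ℕ) (F : List Bool → ℝ) (lam : ℝ) (wt : Bool → ℝ) (A : List ℕ)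
    (v : Node) : ℝ :=
  match v.1 with
  | .f => pinned m F wt (pattern m A v.2)
  | .g => lam
  | .w => 1

theorem prod_map_pattern {m : ℕ} (es : List ℕ) (hes : es.length = m) (A : List ℕ)
    (h : Bool → Bool → ℝ) (p : ℕ → Bool) :
    (es.map fun e => h (decide (e ∈ A)) (p e)).prod =
      ∏ i : Fin m, h (pattern m A es i) ((es.map p).getD i false) := by
  subst hes
  rw [← List.prod_ofFn]
  congr 1
  refine List.ext_getElem (by simp) fun i h1 h2 => ?_
  have hi : i < es.length := by simpa using h1
  simp [pattern]

theorem ends_f_eq_flatMap_filter (V : List Node) :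
    ends .f V = (V.filter (·.1 = .f)).flatMap (·.2) := by
  induction V with
  | nil => rfl
  | cons v V ih =>
    by_cases h : v.1 = .f <;> simp [ends_cons, h, ih]

/-- If `g` is a multiple of `[0, 1]^{⊗ n}`, then all edges at vertices of kind `g` are pinned, and
the value is a product over the vertices. -/
theorem gridValue_of_pinning {ar : Kind → ℕ} {V : List Node} (hV : IsGrid ar V)
    (hw : ar .w = 1) (F G : List Bool → ℝ) (wt : Bool → ℝ) (lam : ℝ)
    (hG : ∀ bs, bs.length = ar .g → G bs = lam * (bs.map (edgeWeight wt false)).prod) :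
    gridValue (kindVal F G wt) V =
      (V.map (factor (ar .f) F lam wt (ends .w V))).prod := by
  have hsplit : ∀ V : List Node, (∀ v ∈ V, v.2.length = ar v.1) → ∀ p,
      nodeProd (kindVal F G wt) V p = (V.map fun v => if v.1 = .g then lam else 1).prod *
        ((V.filter (·.1 = .f)).map fun v => F (v.2.map p)).prod *
        (((ends .g V).map fun e => edgeWeight wt false (p e)).prod *
          ((ends .w V).map fun e => edgeWeight wt true (p e)).prod) := by
    intro V hV p
    induction V with
    | nil => simp [nodeProd, ends]
    | cons v V ih =>
      have ih' := ih fun v hv => hV v (by simp [hv])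
      have hv := hV v (by simp)
      obtain ⟨κ, es⟩ := v
      simp only [nodeProd, List.map_cons, List.prod_cons, ends_cons, List.map_append,
        List.prod_append] at ih' ⊢
      rw [ih']
      rcases κ with _ | _ | _
      · simp [kindVal]
        ring
      · simp only [kindVal, hG (es.map p) (by simpa using hv)]
        simp [Function.comp_def]
        ring
      · obtain ⟨e, he⟩ := List.length_eq_one_iff.1 (hv.trans hw)
        dsimp only at he
        subst he
        simp [kindVal, edgeWeight]
        ring
  have hends := ends_f_eq_flatMap_filter V
  have hdisj := (List.nodup_append'.1 (hV.perm.nodup_iff.1 hV.nodup)).2.2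
  -- the weights of the edges are regrouped according to the vertices of kind `f`
  have hregroup : ∀ p : ℕ → Bool, ((ends .g V).map fun e => edgeWeight wt false (p e)).prod *
      ((ends .w V).map fun e => edgeWeight wt true (p e)).prod =
      ((V.filter (·.1 = .f)).map fun v =>
        (v.2.map fun e => edgeWeight wt (decide (e ∈ ends .w V)) (p e)).prod).prod := by
    intro p
    have h1 : (ends .g V).map (fun e => edgeWeight wt false (p e)) =
        (ends .g V).map fun e => edgeWeight wt (decide (e ∈ ends .w V)) (p e) :=
      List.map_congr_left fun e he => by
        have : e ∉ ends .w V := fun h => hdisj he h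
        simp [this]
    have h2 : (ends .w V).map (fun e => edgeWeight wt true (p e)) =
        (ends .w V).map fun e => edgeWeight wt (decide (e ∈ ends .w V)) (p e) :=
      List.map_congr_left fun e he => by simp [he]
    rw [h1, h2, ← List.prod_append, ← List.map_append,
      ← (hV.perm.map fun e => edgeWeight wt (decide (e ∈ ends .w V)) (p e)).prod_eq]
    conv_lhs => rw [hends]
    rw [List.map_flatMap, List.flatMap_def, List.prod_flatten, List.map_map]
    rfl
  have hprod : ∀ p, nodeProd (kindVal F G wt) V p =
      (V.map fun v => if v.1 = .g then lam else 1).prod *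
        ((V.filter (·.1 = .f)).map fun v => (fun bs : List Bool => F bs * ∏ i : Fin (ar .f),
          edgeWeight wt (pattern (ar .f) (ends .w V) v.2 i) (bs.getD i false))
            (v.2.map p)).prod := by
    intro p
    rw [hsplit V hV.length p, hregroup p, mul_assoc, ← List.prod_map_mul]
    congr 2
    refine List.map_congr_left fun v hv => ?_
    obtain ⟨hv, hf⟩ := List.mem_filter.1 hv
    rw [prod_map_pattern (m := ar .f) v.2 (by rw [hV.length v hv, of_decide_eq_true hf])
      (ends .w V) (edgeWeight wt) p]
  have hfactor : ∀ A (V : List Node), (V.map fun v => if v.1 = .g then lam else 1).prod *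
      ((V.filter (·.1 = .f)).map fun v => pinned (ar .f) F wt (pattern (ar .f) A v.2)).prod =
      (V.map (factor (ar .f) F lam wt A)).prod := by
    intro A V
    induction V with
    | nil => simp
    | cons v V ih =>
      obtain ⟨κ, es⟩ := v
      rw [List.map_cons, List.map_cons, List.prod_cons, List.prod_cons, ← ih]
      rcases κ with _ | _ | _ <;> simp [factor] <;> ring
  have hnd := hV.nodup
  rw [hends] at hnd
  rw [gridValue, sumBits_congr _ hprod, sumBits_const_mul, hends,
    sumBits_flatMap _ _ (fun v p => (fun bs : List Bool => F bs * ∏ i : Fin (ar .f),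
          edgeWeight wt (pattern (ar .f) (ends .w V) v.2 i) (bs.getD i false)) (v.2.map p)) hnd
      fun v _ => dependsOn_list_map (s := (v.2.toFinset : Set ℕ)) v.2
        (fun _ he => by simpa using he) (fun bs : List Bool => F bs * ∏ i : Fin (ar .f),
          edgeWeight wt (pattern (ar .f) (ends .w V) v.2 i) (bs.getD i false)), ← hfactor]
  congr 2
  refine List.map_congr_left fun v hv => ?_
  have hv1 := (List.nodup_flatMap.1 hnd).1 v hv
  obtain ⟨hv, hf⟩ := List.mem_filter.1 hv
  have hv2 : v.2.length = ar .f := by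
    rw [hV.length v hv, of_decide_eq_true hf]
  refine (sumBits_toFinset hv1 fun bs : List Bool => F bs * ∏ i : Fin (ar .f),
    edgeWeight wt (pattern (ar .f) (ends .w V) v.2 i) (bs.getD i false)).trans ?_
  rw [hv2]
  rfl

/-! ### Descriptions of numbers -/

/-- Every number of the field has a formula. -/
theorem exists_formula {r : ℕ} (a : Fin r → ℝ) {v : ℝ}
    (hv : v ∈ Subfield.closure (Set.range a)) : ∃ e : Formula r, e.HasValue a v := by
  induction hv using Subfield.closure_induction with
  | mem x hx =>
    obtain ⟨i, rfl⟩ := hx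
    exact ⟨_, .gen i⟩
  | one => exact ⟨_, .one⟩
  | add x y _ _ hx hy =>
    obtain ⟨e, he⟩ := hx
    obtain ⟨e', he'⟩ := hy
    exact ⟨_, .add he he'⟩
  | neg x _ hx =>
    obtain ⟨e, he⟩ := hx
    exact ⟨_, .neg he⟩
  | inv x _ hx =>
    obtain ⟨e, he⟩ := hx
    by_cases h : x = 0
    · subst h
      exact ⟨_, by simpa using he⟩
    · exact ⟨_, .inv he h⟩
  | mul x y _ _ hx hy =>
    obtain ⟨e, he⟩ := hx
    obtain ⟨e', he'⟩ := hy
    exact ⟨_, .mul he he'⟩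

theorem describes_zero {r : ℕ} (a : Fin r → ℝ) : Describes a (encodeNats [0]) 0 :=
  ⟨.zero, rfl, .zero⟩

theorem describes_one {r : ℕ} (a : Fin r → ℝ) : Describes a (encodeNats [1]) 1 :=
  ⟨.one, rfl, .one⟩

/-- In Polish notation, a description is multiplied by a factor by putting a prefix in front. -/
theorem exists_mul_prefix {r : ℕ} (a : Fin r → ℝ) {c : ℝ}
    (hc : c ∈ Subfield.closure (Set.range a)) :
    ∃ L : List ℕ, ∀ w v, Describes a w v → Describes a (encodeNats L ++ w) (c * v) := by
  obtain ⟨e, he⟩ := exists_formula a hc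
  refine ⟨4 :: e.tokens, ?_⟩
  rintro w v ⟨e', rfl, he'⟩
  exact ⟨.mul e e', by simp [Formula.tokens, ← encodeNats_append], .mul he he'⟩

/-! ### Signature grids as lists of vertices -/

/-- The value of a signature on a list of bits: those of the LHS variables come first. -/
def Sig.listVal (S : Sig) (bs : List Bool) : ℝ :=
  S.val (fun i => bs.getD i false) (fun j => bs.getD (S.l + j) false)

/-- The kind of a vertex and the edges at its variables, those on the LHS first. -/
def Vertex.node (flip : Bool) {S : Fin 3 → Sig} (v : Vertex S) : Node :=
  (Kind.ofLabel flip v.label, List.ofFn v.left ++ List.ofFn v.right)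

/-- The vertices of a signature grid. -/
def Grid.nodes (flip : Bool) {S : Fin 3 → Sig} (Ω : Grid S) : List Node :=
  Ω.vertices.map (Vertex.node flip)

/-- The vertex with given kind and edges. -/
def Vertex.ofNode (flip : Bool) (S : Fin 3 → Sig) (v : Node) : Vertex S where
  label := v.1.label flip
  left i := v.2.getD i 0
  right j := v.2.getD ((S (v.1.label flip)).l + j) 0

/-- The edges on the LHS of a vertex. -/
def leftPart (flip : Bool) (S : Fin 3 → Sig) (v : Node) : List ℕ :=
  v.2.take (S (v.1.label flip)).l

/-- The edges on the RHS of a vertex. -/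
def rightPart (flip : Bool) (S : Fin 3 → Sig) (v : Node) : List ℕ :=
  v.2.drop (S (v.1.label flip)).l

section nodes

variable {flip : Bool} {S : Fin 3 → Sig}

theorem Vertex.length_node (v : Vertex S) : (v.node flip).2.length =
    (S ((v.node flip).1.label flip)).l + (S ((v.node flip).1.label flip)).r := by
  simp [Vertex.node]

theorem Vertex.leftPart_node (v : Vertex S) :
    leftPart flip S (v.node flip) = List.ofFn v.left := by
  simp only [leftPart, Vertex.node, Kind.label_ofLabel]
  exact List.take_left' (by simp)

theorem Vertex.rightPart_node (v : Vertex S) :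
    rightPart flip S (v.node flip) = List.ofFn v.right := by
  simp only [rightPart, Vertex.node, Kind.label_ofLabel]
  exact List.drop_left' (by simp)

theorem Vertex.node_ofNode (v : Node)
    (hv : v.2.length = (S (v.1.label flip)).l + (S (v.1.label flip)).r) :
    (Vertex.ofNode flip S v).node flip = v := by
  refine Prod.ext (by simp [Vertex.node, Vertex.ofNode]) ?_
  refine List.ext_getElem (by simp [Vertex.node, Vertex.ofNode, hv]) fun i h1 h2 => ?_
  simp only [Vertex.node, Vertex.ofNode, List.getElem_append, List.length_ofFn, List.getElem_ofFn]
  split_ifs with h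
  · simp [h2]
  · have e : (S (v.1.label flip)).l + (i - (S (v.1.label flip)).l) = i := by omega
    simp [e, h2]

theorem Grid.encode_eq (flip : Bool) (Ω : Grid S) :
    Ω.encode = encodeNats (tokens flip (Ω.nodes flip)) := by
  simp [Grid.encode, tokens, Grid.nodes, Vertex.node, List.flatMap_map]

theorem leftEnds_eq (flip : Bool) (V : List (Vertex S)) :
    leftEnds V = (V.map (Vertex.node flip)).flatMap (leftPart flip S) := by
  simp only [leftEnds, List.flatMap_map, Vertex.leftPart_node]

theorem rightEnds_eq (flip : Bool) (V : List (Vertex S)) :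
    rightEnds V = (V.map (Vertex.node flip)).flatMap (rightPart flip S) := by
  simp only [rightEnds, List.flatMap_map, Vertex.rightPart_node]

theorem Vertex.listVal_node (v : Vertex S) (p : ℕ → Bool) :
    (S ((v.node flip).1.label flip)).listVal ((v.node flip).2.map p) =
      (S v.label).val (fun i => p (v.left i)) (fun j => p (v.right j)) := by
  have hS : S ((v.node flip).1.label flip) = S v.label := by simp [Vertex.node]
  rw [hS, Sig.listVal]
  congr 1
  · funext i
    simp [Vertex.node, List.getElem?_append]
  · funext j
    simp [Vertex.node]

theorem Grid.value_eq (flip : Bool) (Ω : Grid S) : Ω.value =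
    sumBits Ω.edges (nodeProd (fun κ => (S (κ.label flip)).listVal) (Ω.nodes flip)) := by
  refine Finset.sum_congr rfl fun T _ => ?_
  simp only [nodeProd, Grid.nodes, List.map_map]
  congr 1
  refine List.map_congr_left fun v _ => ?_
  exact (Vertex.listVal_node v fun e => decide (e ∈ T)).symm

/-- The numbers of LHS and RHS variables of the three kinds of signatures, with the vertices of kind
`f` on one side and those of kinds `g` and `w` on the other. -/
def IsBipartite (flip : Bool) (S : Fin 3 → Sig) (ar : Kind → ℕ) : Prop :=
  ∀ κ : Kind, (S (κ.label flip)).l = (if (κ = .f) = (flip = false) then ar κ else 0) ∧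
    (S (κ.label flip)).r = if (κ = .f) = (flip = false) then 0 else ar κ

theorem IsBipartite.isGrid {ar : Kind → ℕ} (h : IsBipartite flip S ar) (Ω : Grid S) :
    IsGrid ar (Ω.nodes flip) ∧ Ω.edges = (ends .f (Ω.nodes flip)).toFinset := by
  have hlen : ∀ v ∈ Ω.nodes flip, v.2.length = ar v.1 := by
    intro v hv
    obtain ⟨v, _, rfl⟩ := List.mem_map.1 hv
    rw [Vertex.length_node, (h _).1, (h _).2]
    split_ifs <;> simp
  have hl : leftEnds Ω.vertices = (Ω.nodes flip).flatMap fun v =>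
      if (v.1 = .f) = (flip = false) then v.2 else [] := by
    rw [leftEnds_eq flip]
    refine List.flatMap_congr fun v hv => ?_
    rw [leftPart, (h _).1]
    split_ifs
    · rw [← hlen v hv, List.take_length]
    · rfl
  have hr : rightEnds Ω.vertices = (Ω.nodes flip).flatMap fun v =>
      if (v.1 = .f) = (flip = false) then [] else v.2 := by
    rw [rightEnds_eq flip]
    refine List.flatMap_congr fun v hv => ?_
    rw [rightPart, (h _).1]
    split_ifs
    · rw [← hlen v hv, List.drop_length]
    · rfl
  have hother : ∀ V : List Node, (V.flatMap fun v => if v.1 = .f then [] else v.2).Perm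
      (ends .g V ++ ends .w V) := by
    intro V
    induction V with
    | nil => rfl
    | cons v V ih =>
      rw [List.perm_iff_count] at ih ⊢
      intro e
      have := ih e
      obtain ⟨κ, es⟩ := v
      rcases κ with _ | _ | _ <;> simp [ends_cons] at this ⊢ <;> omega
  have hperm := Ω.perm
  have hnd := Ω.nodup
  cases flip with
  | false =>
    have hl' : leftEnds Ω.vertices = ends .f (Ω.nodes false) := by simpa [ends] using hl
    have hr' : rightEnds Ω.vertices = (Ω.nodes false).flatMap fun v =>
        if v.1 = .f then [] else v.2 := by simpa using hr
    refine ⟨⟨hlen, hl' ▸ hnd, ?_⟩, by rw [Grid.edges, hl']⟩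
    rw [hl', hr'] at hperm
    exact hperm.trans (hother _)
  | true =>
    have hl' : leftEnds Ω.vertices = (Ω.nodes true).flatMap fun v =>
        if v.1 = .f then [] else v.2 := by
      rw [hl]
      refine List.flatMap_congr fun v _ => ?_
      by_cases hv : v.1 = .f <;> simp [hv]
    have hr' : rightEnds Ω.vertices = ends .f (Ω.nodes true) := by
      rw [hr]
      refine List.flatMap_congr fun v _ => ?_
      by_cases hv : v.1 = .f <;> simp [hv]
    refine ⟨⟨hlen, hr' ▸ hperm.nodup_iff.1 hnd, ?_⟩, ?_⟩
    · rw [hl', hr'] at hperm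
      exact hperm.symm.trans (hother _)
    · rw [Grid.edges, List.toFinset_eq_of_perm _ _ hperm, hr']

/-- The numbers of LHS and RHS variables if the signatures of kind `w` are binary and straddled. -/
def IsStraddled (flip : Bool) (S : Fin 3 → Sig) (ar : Kind → ℕ) : Prop :=
  ∀ κ : Kind, (S (κ.label flip)).l =
      (if κ = .w then 1 else if (κ = .f) = (flip = false) then ar κ else 0) ∧
    (S (κ.label flip)).r =
      if κ = .w then 1 else if (κ = .f) = (flip = false) then 0 else ar κ

theorem IsStraddled.exists_grid {ar : Kind → ℕ} (h : IsStraddled flip S ar) (V : List Node)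
    (hlen : ∀ v ∈ V, v.2.length = if v.1 = .w then 2 else ar v.1) (hnd : (nearEnds flip V).Nodup)
    (hperm : (nearEnds flip V).Perm (farEnds flip V)) :
    ∃ Ω : Grid S, Ω.nodes flip = V ∧ Ω.edges = (nearEnds flip V).toFinset := by
  have hnodes : (V.map (Vertex.ofNode flip S)).map (Vertex.node flip) = V := by
    rw [List.map_map]
    conv_rhs => rw [← List.map_id V]
    refine List.map_congr_left fun v hv => Vertex.node_ofNode v ?_
    rw [hlen v hv, (h _).1, (h _).2]
    split_ifs <;> simp
  have hpart : ∀ v ∈ V, (leftPart flip S v, rightPart flip S v) =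
      if flip then
        ((match v.1 with | .f => [] | .g => v.2 | .w => [v.2.getD (if flip then 0 else 1) 0]),
          (match v.1 with | .f => v.2 | .g => [] | .w => [v.2.getD (if flip then 1 else 0) 0]))
      else
        ((match v.1 with | .f => v.2 | .g => [] | .w => [v.2.getD (if flip then 1 else 0) 0]),
          (match v.1 with
            | .f => [] | .g => v.2 | .w => [v.2.getD (if flip then 0 else 1) 0])) := by
    intro v hv
    have hv := hlen v hv
    rw [leftPart, rightPart, (h _).1]
    obtain ⟨κ, es⟩ := v
    rcases κ with _ | _ | _
    · cases flip <;> simp_all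
    · cases flip <;> simp_all
    · obtain ⟨e, e', rfl⟩ := List.length_eq_two.1 hv
      cases flip <;> simp
  have hl : leftEnds (V.map (Vertex.ofNode flip S)) =
      if flip then farEnds flip V else nearEnds flip V := by
    rw [leftEnds_eq flip, hnodes]
    cases flip <;>
    exact List.flatMap_congr fun v hv => congrArg Prod.fst (hpart v hv)
  have hr : rightEnds (V.map (Vertex.ofNode flip S)) =
      if flip then nearEnds flip V else farEnds flip V := by
    rw [rightEnds_eq flip, hnodes]
    cases flip <;>
    exact List.flatMap_congr fun v hv => congrArg Prod.snd (hpart v hv)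
  refine ⟨⟨V.map (Vertex.ofNode flip S), ?_, ?_⟩, hnodes, ?_⟩
  · rw [hl]
    split_ifs
    exacts [hperm.nodup_iff.1 hnd, hnd]
  · rw [hl, hr]
    split_ifs
    exacts [hperm.symm, hperm]
  · simp only [Grid.edges]
    rw [hl]
    split_ifs
    · exact List.toFinset_eq_of_perm _ _ hperm.symm
    · rfl

end nodes

/-! ### The reductions -/

/-- The auxiliary stacks at the start. -/
abbrev emptyWork : Work := fun _ => []

theorem startStore_eq (w : List Bool) :
    startStore w = store w [] [] [] emptyWork fun _ => [] := by
  funext j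
  rcases j with _ | _ | _ | _ | _ | _ | _ | _ | _ | j <;> rfl

@[simp] theorem size_emptyWork : Work.size emptyWork = 0 := rfl

theorem turingReducible_of_computes {r : ℕ} {a : Fin r → ℝ} {A B : Problem}
    {F : List Bool × Work → List Bool × Work} (hF : Computes F)
    (h : ∀ I : A.Inst, Describes a (F (A.encode I, emptyWork)).1 (A.value I)) :
    TuringReducible a A B := by
  obtain ⟨P, p, hP⟩ := hF
  refine ⟨P, fun q => ⟨p, fun O _ _ w => ?_⟩⟩
  obtain ⟨t, ht, hE⟩ := hP O (w, emptyWork) fun _ => []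
  refine ⟨_, t, startStore_eq w ▸ hE, ?_, ?_⟩
  · simp only [size_emptyWork, add_zero] at ht
    omega
  · rintro I rfl
    exact h I

/-- If `g` is a multiple of `[0, 1]^{⊗ n}`, the Holant problem can be solved in polynomial time
without an oracle. -/
theorem turingReducible_of_pinning {r : ℕ} {a : Fin r → ℝ} {flip : Bool} {S : Fin 3 → Sig}
    {ar : Kind → ℕ} {F G : List Bool → ℝ} {wt : Bool → ℝ} {lam : ℝ} (B : Problem)
    (hS : IsBipartite flip S ar)
    (hval : (fun κ : Kind => (S (κ.label flip)).listVal) = kindVal F G wt) (hw : ar .w = 1)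
    (hG : ∀ bs, bs.length = ar .g → G bs = lam * (bs.map (edgeWeight wt false)).prod)
    (hF : ∀ bs, F bs ∈ Subfield.closure (Set.range a))
    (hwt : ∀ b, wt b ∈ Subfield.closure (Set.range a))
    (hlam : lam ∈ Subfield.closure (Set.range a)) :
    TuringReducible a (holant S) B := by
  have hpin : ∀ β : Fin (ar .f) → Bool,
      pinned (ar .f) F wt β ∈ Subfield.closure (Set.range a) := by
    refine fun β => sumBits_mem _ fun q => mul_mem (hF _) (Subfield.prod_mem _ fun i _ => ?_)
    unfold edgeWeight
    split_ifs
    exacts [hwt _, one_mem _, zero_mem _]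
  choose cf hcf using fun β => exists_mul_prefix a (hpin β)
  obtain ⟨cg, hcg⟩ := exists_mul_prefix a hlam
  refine turingReducible_of_computes ((Computes.load .buf).comp
    (((collecting (ar .f) cf cg).automaton flip ar).computes.comp
      ((Computes.load .out).comp ((marking flip).automaton flip ar).computes))) ?_
  intro (Ω : Grid S)
  obtain ⟨hgrid, hedges⟩ := hS.isGrid Ω
  obtain ⟨l, hl, hmark⟩ := marking_result (flip := flip) (Grid.nodes flip Ω)
  have hvalue : (holant S).value Ω = gridValue (kindVal F G wt) (Grid.nodes flip Ω) := by
    change Grid.value Ω = _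
    rw [Grid.value_eq flip, hval, hedges]
    rfl
  have henc : (holant S).encode Ω = encodeNats (tokens flip (Grid.nodes flip Ω)) :=
    Grid.encode_eq flip Ω
  rw [hvalue, gridValue_of_pinning hgrid hw F G wt lam hG, henc]
  dsimp only
  rw [Parser.automaton_result _ _ hgrid.length, hmark, mkWork_out, List.reverse_reverse]
  simp only [List.append_nil]
  rw [Parser.automaton_result _ _ hgrid.length]
  obtain ⟨h1, h2⟩ := collecting_foldl (cf := cf) (cg := cg) (ends .w (Grid.nodes flip Ω))
    (Grid.nodes flip Ω) (fun v hv h => by rw [hgrid.length v hv, h])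
    ((fun _ => false), Function.update (mkWork
        ((encodeNats (tokens flip (Grid.nodes flip Ω))).reverse) (encodeNats [1]) [] l
        []) .out []) (by simp) (by simpa using hl)
  simp only [Parser.result, runActs_cons, runActs_nil, Act.run, reduceCtorEq, if_false]
  rw [Function.update_of_ne (by simp), Function.update_self, h1, h2]
  simp only [ne_eq, reduceCtorEq, not_false_eq_true, Function.update_of_ne]
  -- the factors are prepended one after the other
  have key : ∀ (V : List Node) (A : List ℕ) (w : List Bool) (x : ℝ), Describes a w x →
      Describes a (V.foldl (fun l v => encodeNats (factorTokens cf cg A v) ++ l) w)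
        ((V.map (factor (ar .f) F lam wt A)).prod * x) := by
    intro V A
    induction V with
    | nil => intro w x h; simpa using h
    | cons v V ih =>
      intro w x h
      rw [List.foldl_cons, List.map_cons, List.prod_cons]
      have hv : Describes a (encodeNats (factorTokens cf cg A v) ++ w)
          (factor (ar .f) F lam wt A v * x) := by
        obtain ⟨κ, es⟩ := v
        rcases κ with _ | _ | _
        · exact hcf _ w x h
        · exact hcg w x h
        · simpa [factorTokens, factor] using h
      have e : ∀ b c : ℝ, b * c * x = c * (b * x) := fun b c => by ring
      rw [e]
      exact ih _ _ hv
  simpa using key (Grid.nodes flip Ω) (ends .w (Grid.nodes flip Ω)) _ 1 (describes_one a)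

/-- The embedding of the stacks of a subroutine: it shares stack `0`, and all its other stacks are
disjoint from those of an automaton. -/
def shiftStack : ℕ → ℕ
  | 0 => 0
  | i + 1 => i + 9

theorem shiftStack_injective : Function.Injective shiftStack := by
  intro i j h
  rcases i with _ | i <;> rcases j with _ | j <;> simp [shiftStack] at h ⊢
  exact h

/-- The loop that puts the bits `w` in front of stack `0` once for every bit of stack `7`. -/
theorem exec_prefixLoop (O : List Bool → List Bool) (w : List Bool) (l : List Bool) (s : Store)
    (hs : s 7 = l) : ∃ s' t, Exec O (.loop 7 true (.seq (.pop 7) (pushAll 0 w))) s s' t ∧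
      t ≤ l.length * (w.length + 3) + 1 ∧ (∀ j, j ≠ 0 → j ≠ 7 → s' j = s j) ∧
      (∀ K, l = List.replicate K true → s' 0 = (fun v => w ++ v)^[K] (s 0)) := by
  induction l generalizing s with
  | nil =>
    refine ⟨s, 1, .loop_done (by simp [hs]), by simp, fun _ _ _ => rfl, fun K hK => ?_⟩
    obtain rfl : K = 0 := by simpa using congrArg List.length hK.symm
    rfl
  | cons b l ih =>
    cases b with
    | false =>
      refine ⟨s, 1, .loop_done (by simp [hs]), by simp, fun _ _ _ => rfl, fun K hK => ?_⟩
      have : false ∈ List.replicate K true := hK ▸ List.mem_cons_self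
      simp at this
    | true =>
      have h1 := Exec.pop (O := O) s 7
      rw [hs, List.tail_cons] at h1
      have h2 := exec_pushAll O 0 w (Function.update s 7 l)
      obtain ⟨s', t, hE, ht, hj, hK⟩ := ih (Function.update (Function.update s 7 l) 0
        (w ++ Function.update s 7 l 0)) (by simp)
      refine ⟨s', _, .loop_step (by simp [hs]) (.seq h1 h2) hE, ?_, ?_, ?_⟩
      · rw [List.length_cons, add_mul]
        omega
      · intro j h0 h7
        rw [hj j h0 h7, Function.update_of_ne h0, Function.update_of_ne h7]
      · intro K hK'
        rcases K with _ | K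
        · simp at hK'
        · rw [List.replicate_succ, List.cons.injEq] at hK'
          rw [hK K hK'.2]
          simp

/-- A program that prepares the input by automata, calls a subroutine unless the flag `buf` is
set, and then puts a fixed prefix in front of the answer as often as the counter `mem` says, and
finally the contents of `scr`. If the flag is set, the answer is zero. -/
theorem turingReducible_of_subroutine {r : ℕ} {a : Fin r → ℝ} {A D B : Problem}
    (hD : TuringReducible a D B) {F₁ F₂ : List Bool × Work → List Bool × Work}
    (hF₁ : Computes F₁) (hF₂ : Computes F₂) (w₀ : List Bool)
    (h : ∀ I : A.Inst, ((F₁ (A.encode I, emptyWork)).2 .buf = [true] ∧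
        (F₁ (A.encode I, emptyWork)).1 = [] ∧ A.value I = 0) ∨
      ((F₁ (A.encode I, emptyWork)).2 .buf = [] ∧ ∃ (J : D.Inst) (K : ℕ),
        (F₂ (F₁ (A.encode I, emptyWork))).1 = D.encode J ∧
        (F₂ (F₁ (A.encode I, emptyWork))).2 .mem = List.replicate K true ∧
        ∀ w, Describes a w (D.value J) →
          Describes a (((F₂ (F₁ (A.encode I, emptyWork))).2 .scr).reverse ++
            (fun v => w₀ ++ v)^[K] w) (A.value I))) :
    TuringReducible a A B := by
  obtain ⟨P₁, p₁, hP₁⟩ := hF₁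
  obtain ⟨P₂, p₂, hP₂⟩ := hF₂
  obtain ⟨Q, hQ⟩ := hD
  refine ⟨.seq P₁ (.branch 6 true (pushAll 0 (encodeNats [0])) (.seq P₂ (.seq (Q.rename shiftStack)
    (.seq (.loop 7 true (.seq (.pop 7) (pushAll 0 w₀))) (moveProg 8 0))))), fun q => ?_⟩
  obtain ⟨p, hp⟩ := hQ q
  refine ⟨p₁ + p₂.comp p₁ + p.comp (p₂.comp p₁) + p₂.comp p₁ * ((w₀.length + 3 : ℕ) + 6) + 20,
    fun O hO hq w => ?_⟩
  obtain ⟨t₁, ht₁, hE₁⟩ := hP₁ O (w, emptyWork) fun _ => []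
  rw [← startStore_eq] at hE₁
  simp only [size_emptyWork, add_zero] at ht₁
  have h6 : store (F₁ (w, emptyWork)).1 [] [] [] (F₁ (w, emptyWork)).2 (fun _ => []) 6 =
    (F₁ (w, emptyWork)).2 .buf := rfl
  simp only [Polynomial.eval_add, Polynomial.eval_mul, Polynomial.eval_comp,
    Polynomial.eval_natCast, Polynomial.eval_ofNat, Nat.cast_id]
  by_cases hflag : ((F₁ (w, emptyWork)).2 .buf).head? = some true
  · refine ⟨_, _, .seq hE₁ (.branch_pos (by rw [h6, hflag]) (exec_pushAll O 0 _ _)), ?_, ?_⟩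
    · simp only [encodeNats_singleton, List.replicate_zero, List.nil_append, List.length_singleton]
      omega
    · rintro I rfl
      rcases h I with ⟨_, h2, h3⟩ | ⟨h1, _⟩
      · rw [update_store_zero, h3]
        simpa [store, h2] using describes_zero a
      · rw [h1] at hflag
        simp at hflag
  · obtain ⟨t₂, ht₂, hE₂⟩ := hP₂ O (F₁ (w, emptyWork)) fun _ => []
    set c := F₂ (F₁ (w, emptyWork)) with hc
    obtain ⟨s, t₃, hE₃, ht₃, hs⟩ := hp O hO hq c.1
    obtain ⟨s₃, hE₃', hs₃, hn₃⟩ := hE₃.rename shiftStack_injective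
      (store c.1 [] [] [] c.2 fun _ => []) (by
        rintro (_ | i)
        · rfl
        · simp [shiftStack, startStore, store])
    have hfix : ∀ j, 0 < j → j < 9 → s₃ j = store c.1 [] [] [] c.2 (fun _ => []) j := by
      intro j h0 h9
      refine hn₃ j fun i => ?_
      rcases i with _ | i <;> simp only [shiftStack] <;> omega
    obtain ⟨s₄, t₄, hE₄, ht₄, hn₄, hK₄⟩ := exec_prefixLoop O w₀ (c.2 .mem) s₃
      (hfix 7 (by norm_num) (by norm_num))
    obtain ⟨t₅, ht₅, hE₅⟩ := exec_moveProg O (i := 8) (j := 0) (by norm_num) (by norm_num)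
      (by norm_num) s₄ (by
        rw [hn₄ 3 (by norm_num) (by norm_num), hfix 3 (by norm_num) (by norm_num)]
        rfl)
    have h8 : s₄ 8 = c.2 .scr := by
      rw [hn₄ 8 (by norm_num) (by norm_num), hfix 8 (by norm_num) (by norm_num)]
      rfl
    have h0 : s₃ 0 = s 0 := hs₃ 0
    refine ⟨_, _, .seq hE₁ (.branch_neg (by rw [h6]; exact hflag)
      (.seq hE₂ (.seq hE₃' (.seq hE₄ hE₅)))), ?_, ?_⟩
    · have m1 : (F₁ (w, emptyWork)).1.length + Work.size (F₁ (w, emptyWork)).2 ≤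
          p₁.eval w.length := by omega
      have m2 := polynomial_eval_mono p₂ m1
      have m3 : c.1.length ≤ p₂.eval (p₁.eval w.length) := by omega
      have m4 := polynomial_eval_mono p m3
      have m5 : (c.2 .mem).length ≤ p₂.eval (p₁.eval w.length) :=
        (c.2.length_le_size .mem).trans (by omega)
      have m6 : (s₄ 8).length ≤ p₂.eval (p₁.eval w.length) := by
        rw [h8]
        exact (c.2.length_le_size .scr).trans (by omega)
      have m7 : (c.2 .mem).length * (w₀.length + 3) ≤
          p₂.eval (p₁.eval w.length) * (w₀.length + 3) := Nat.mul_le_mul_right _ m5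
      rw [mul_add]
      omega
    · rintro I rfl
      rcases h I with ⟨h1, _⟩ | ⟨_, J, K, hJ, hK, hdesc⟩
      · exact absurd (by rw [h1]; rfl) hflag
      · rw [Function.update_of_ne (by norm_num), Function.update_self, h8, hK₄ K hK, h0]
        exact hdesc _ (hs J hJ.symm)

/-- If the contraction of `g` with the unary signature `u` does not vanish, then the unary
signature `wt` can be realized with the help of the straddled signature `u ⊗ wt`. A gadget makes
the number of unary vertices divisible by the arity of `g`; then these vertices are made straddled,
and the new edges are absorbed by new vertices with label `g`. The known factors of the value, for
the gadget and for every new vertex, are divided out in front of the answer of the oracle. If no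
gadget exists for the residue class of the grid, the value of the grid is zero. -/
theorem turingReducible_of_contraction {r : ℕ} {a : Fin r → ℝ} {flip : Bool} {S T : Fin 3 → Sig}
    {ar : Kind → ℕ} {F G : List Bool → ℝ} {u wt : Bool → ℝ} {B : Problem}
    (hS : IsBipartite flip S ar)
    (hSval : (fun κ : Kind => (S (κ.label flip)).listVal) = kindVal F G wt)
    (hT : IsStraddled flip T ar)
    (hTval : (fun κ : Kind => (T (κ.label flip)).listVal) = splitVal flip F G u wt)
    (hw : ar .w = 1) (hg : ar .g ≠ 0)
    (hF : ∀ bs, F bs ∈ Subfield.closure (Set.range a))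
    (hG : ∀ bs, G bs ∈ Subfield.closure (Set.range a))
    (hu : ∀ b, u b ∈ Subfield.closure (Set.range a))
    (hwt : ∀ b, wt b ∈ Subfield.closure (Set.range a))
    (hC : contraction (ar .g) G u ≠ 0) (hD : TuringReducible a (holant T) B) :
    TuringReducible a (holant S) B := by
  classical
  have : NeZero (ar .g) := ⟨hg⟩
  set C := contraction (ar .g) G u with hCdef
  have hCmem : C ∈ Subfield.closure (Set.range a) :=
    sumBits_mem _ fun q => mul_mem (list_prod_mem fun x hx => by
      obtain ⟨b, _, rfl⟩ := List.mem_map.1 hx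
      exact hu b) (hG _)
  have hvalmem : ∀ W, gridValue (kindVal F G wt) W ∈ Subfield.closure (Set.range a) :=
    fun W => sumBits_mem _ fun p => list_prod_mem fun x hx => by
      obtain ⟨⟨κ, es⟩, _, rfl⟩ := List.mem_map.1 hx
      cases κ
      exacts [hF _, hG _, hwt _]
  obtain ⟨w₀, hw₀⟩ := exists_mul_prefix a (inv_mem hCmem)
  choose pre hpre using fun W => exists_mul_prefix a (inv_mem (hvalmem W))
  -- one gadget for every residue class, shifted to odd edges, with the prefix for its value
  let good : ZMod (ar .g) → List Node → Prop := fun c W => IsGrid ar W ∧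
    gridValue (kindVal F G wt) W ≠ 0 ∧ c + (W.countP (·.1 = .f) : ℕ) = 0
  let Γ : ZMod (ar .g) → Option (List Node × List ℕ) := fun c =>
    if h : ∃ W, good c W then
      some (h.choose.map (Node.rename (2 * · + 1)), pre h.choose) else none
  refine turingReducible_of_subroutine hD ((doubling flip (ar .g) Γ).automaton flip ar).computes
    ((Computes.load .out).comp ((Computes.load .aux).comp
      (((splitting flip (ar .g)).automaton flip ar).computes.comp (Computes.load .out))))
    (encodeNats w₀) ?_
  intro (Ω : Grid S)
  obtain ⟨hV, hedges⟩ := hS.isGrid Ω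
  set V := Grid.nodes flip Ω with hVdef
  have hvalue : (holant S).value Ω = gridValue (kindVal F G wt) V := by
    change Grid.value Ω = _
    rw [Grid.value_eq flip, hSval, hedges]
    rfl
  have henc : (holant S).encode Ω = encodeNats (tokens flip V) := Grid.encode_eq flip Ω
  rw [hvalue, henc]
  dsimp only
  rw [Parser.automaton_result _ _ hV.length]
  by_cases hex : ∃ W, good (V.countP (·.1 = .f) : ℕ) W
  · right
    have hΓ : Γ (V.countP (·.1 = .f) : ℕ) =
        some (hex.choose.map (Node.rename (2 * · + 1)), pre hex.choose) := dif_pos hex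
    obtain ⟨hW, hW0, hWc⟩ := hex.choose_spec
    set W := hex.choose with hWdef
    rw [doubling_result_some V _ hΓ]
    dsimp only
    refine ⟨rfl, ?_⟩
    have hU := hV.union hW
    have hUval := IsGrid.gridValue_union (kindVal F G wt) hV hW
    set U := V.map (Node.rename (2 * ·)) ++ W.map (Node.rename (2 * · + 1)) with hUdef
    have hcount : ar .g ∣ U.countP (·.1 = .f) := by
      rw [← ZMod.natCast_eq_zero_iff, hUdef, List.countP_append, List.countP_map,
        List.countP_map, Nat.cast_add]
      exact hWc
    obtain ⟨K, hK⟩ := hU.dvd_length_ends hcount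
    obtain ⟨L, hL, hLn, hLK, hgt, hgc⟩ := exists_groups (flip := flip) K _ hK
    have hUw : ∀ v ∈ U, v.1 = .w → v.2.length = 1 := fun v hv h => by
      rw [hU.length v hv, h, hw]
    have hnear := nearEnds_splitGrid (flip := flip) (L := L) hUw
    have hfar := farEnds_splitGrid (flip := flip) (L := L) hUw
    obtain ⟨Ω', hΩ', hedges'⟩ := hT.exists_grid (splitGrid flip U L)
      (length_of_mem_splitGrid hw hU.length hLn)
      (hnear.nodup_iff.2 ((hU.nodup.map IsGrid.double_injective).append
        ((List.nodup_append'.1 (hU.perm.nodup_iff.1 hU.nodup)).2.1.map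
          IsGrid.double_add_one_injective) (IsGrid.double_disjoint _ _)))
      (hnear.trans ((((hU.perm.map _).append_right _).trans (by rw [hL])).trans hfar.symm))
    have hΩval : (holant T).value Ω' = gridValue (kindVal F G wt) V *
        gridValue (kindVal F G wt) W * C ^ K := by
      change Grid.value Ω' = _
      rw [Grid.value_eq flip, hTval, hΩ', hedges', sumBits_splitGrid F G u wt hU hw hL hLn, hLK,
        hUval]
    have hΩenc : (holant T).encode Ω' = encodeNats (tokens flip (splitGrid flip U L)) := by
      rw [← hΩ']
      exact Grid.encode_eq flip Ω'
    have hsplit : (splitting flip (ar .g)).result U (Function.update (mkWork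
          ((encodeNats (tokens flip U)).reverse) [] [] []
          ((encodeNats (pre W)).reverse)) .out []) = mkWork
        ((encodeNats (tokens flip (U.map (splitNode flip)))).reverse)
        ((encodeNats (tokens flip (L.map fun l => (Kind.g, l.map (2 * · + 1))))).reverse)
        []
        (List.replicate K true)
        ((encodeNats (pre W)).reverse) := by
      simp only [Parser.result]
      erw [splitting_foldl U hUw _ (by simp)]
      rw [Work.ext_iff]
      simp [hgt, hgc]
    rw [List.append_nil, mkWork_out, List.reverse_reverse,
      Parser.automaton_result _ _ hU.length, hsplit]
    refine ⟨Ω', K, ?_, by simp, ?_⟩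
    · rw [hΩenc, splitGrid, tokens_append, encodeNats_append]
      simp
    · intro w hdesc
      have hiter : ∀ K v x, Describes a v x →
          Describes a ((fun v => encodeNats w₀ ++ v)^[K] v) (C⁻¹ ^ K * x) := by
        intro K
        induction K with
        | zero => intro v x h; simpa using h
        | succ K ih =>
          intro v x h
          rw [Function.iterate_succ_apply', pow_succ', mul_assoc]
          exact hw₀ _ _ (ih v x h)
      have hfin := hpre W _ _ (hiter K w _ hdesc)
      rw [hΩval] at hfin
      have e : (gridValue (kindVal F G wt) W)⁻¹ * (C⁻¹ ^ K * (gridValue (kindVal F G wt) V *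
          gridValue (kindVal F G wt) W * C ^ K)) = gridValue (kindVal F G wt) V := by
        rw [inv_pow]
        field_simp
      rw [e] at hfin
      simpa using hfin
  · left
    refine ⟨doubling_result_none V (dif_neg hex), rfl, ?_⟩
    by_contra h0
    exact hex (hV.exists_complement (kindVal F G wt) h0 (ar .g))

/-! ### Choosing between the two reductions -/

/-- A signature as a function of the list of its input bits. -/
def ofBits {k : ℕ} (f : (Fin k → Bool) → ℝ) (bs : List Bool) : ℝ := f fun i => bs.getD i false

/-- The arities of the three kinds of signatures. -/
def Kind.arity (k l : ℕ) : Kind → ℕ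
  | .f => k
  | .g => l
  | .w => 1

/-- The signature `[1, x]` as a function of its input bit. -/
def weight (x : ℝ) (b : Bool) : ℝ := if b then x else 1

theorem prod_edgeWeight_eq_one {n : ℕ} {wt : Bool → ℝ} {bs : List Bool} (hlen : bs.length = n)
    (h : (fun i : Fin n => bs.getD i false) = fun _ => true) :
    (bs.map (edgeWeight wt false)).prod = 1 := by
  refine List.prod_eq_one fun z hz => ?_
  obtain ⟨b, hb, rfl⟩ := List.mem_map.1 hz
  obtain ⟨i, hi, rfl⟩ := List.mem_iff_getElem.1 hb
  have := congrFun h ⟨i, hlen ▸ hi⟩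
  simp only [List.getD_eq_getElem _ _ hi] at this
  simp [edgeWeight, this]

theorem prod_edgeWeight_eq_zero {n : ℕ} {wt : Bool → ℝ} {bs : List Bool} (hlen : bs.length = n)
    (h : (fun i : Fin n => bs.getD i false) ≠ fun _ => true) :
    (bs.map (edgeWeight wt false)).prod = 0 := by
  obtain ⟨i, hi⟩ := Function.ne_iff.1 h
  have hi' : (i : ℕ) < bs.length := hlen ▸ i.2
  simp only [List.getD_eq_getElem _ _ hi'] at hi
  refine List.prod_eq_zero (List.mem_map.2 ⟨bs[(i : ℕ)], List.getElem_mem hi', ?_⟩)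
  simp [edgeWeight, hi]

/-- Both parts of the theorem at once: the signature `g` absorbs the unary signatures `[1, y]` that
remain when the vertices labelled `[1, x]` are replaced by straddled ones, unless its support is
contained in the all-ones input, where it pins the neighbouring variables. -/
theorem turingReducible_of_straddled {r : ℕ} {a : Fin r → ℝ} {flip : Bool} {S T : Fin 3 → Sig}
    {k l : ℕ} {f : (Fin k → Bool) → ℝ} {g : (Fin l → Bool) → ℝ} {x y : ℝ} {B : Problem}
    (hS : IsBipartite flip S (Kind.arity k l))
    (hSval : (fun κ : Kind => (S (κ.label flip)).listVal) =
      kindVal (ofBits f) (ofBits g) (weight x))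
    (hT : IsStraddled flip T (Kind.arity k l))
    (hTval : (fun κ : Kind => (T (κ.label flip)).listVal) =
      splitVal flip (ofBits f) (ofBits g) (weight y) (weight x))
    (hg : ∀ β, 0 ≤ g β) (hy : 0 ≤ y)
    (hfa : ∀ α, f α ∈ Subfield.closure (Set.range a))
    (hga : ∀ β, g β ∈ Subfield.closure (Set.range a))
    (hxa : x ∈ Subfield.closure (Set.range a)) (hya : y ∈ Subfield.closure (Set.range a))
    (hD : TuringReducible a (holant T) B)
    (h : y = 0 → g (fun _ => false) = 0 → ∀ β, β ≠ (fun _ => true) → g β = 0) :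
    TuringReducible a (holant S) B := by
  have hweight : ∀ {z : ℝ}, z ∈ Subfield.closure (Set.range a) →
      ∀ b, weight z b ∈ Subfield.closure (Set.range a) := fun hz b => by
    unfold weight
    split_ifs
    exacts [hz, one_mem _]
  by_cases hpin : ∀ β, β ≠ (fun _ => true) → g β = 0
  · refine turingReducible_of_pinning (lam := g fun _ => true) B hS hSval rfl (fun bs hlen => ?_)
      (fun _ => hfa _) (hweight hxa) (hga _)
    by_cases hb : (fun i : Fin l => bs.getD i false) = fun _ => true
    · rw [prod_edgeWeight_eq_one hlen hb, mul_one, ofBits, hb]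
    · rw [prod_edgeWeight_eq_zero hlen hb, mul_zero]
      exact hpin _ hb
  · push Not at hpin
    obtain ⟨β, hβ, hgβ⟩ := hpin
    have hl : l ≠ 0 := by
      rintro rfl
      exact hβ (Subsingleton.elim _ _)
    refine turingReducible_of_contraction hS hSval hT hTval rfl hl (fun _ => hfa _)
      (fun _ => hga _) (hweight hya) (hweight hxa) ?_ hD
    have hnn : ∀ b, 0 ≤ weight y b := fun b => by
      unfold weight
      split_ifs
      exacts [hy, zero_le_one]
    -- a positive term of the contraction: the one of the all-zeros input if `g` does not vanish
    -- there, and otherwise, as then `y ≠ 0`, that of any point in the support of `g`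
    by_cases h0 : g (fun _ => false) = 0
    · have hy0 : y ≠ 0 := fun hy0 => hgβ (h hy0 h0 β hβ)
      refine contraction_ne_zero (fun _ => hg _) hnn
        (fun i => if hi : i < l then β ⟨i, hi⟩ else false) ?_ fun i _ => ?_
      · have : ofBits g ((List.range l).map fun i => if hi : i < l then β ⟨i, hi⟩ else false) =
            g β := congrArg g (funext fun i => by simp)
        exact this ▸ hgβ
      · generalize (if hi : i < l then β ⟨i, hi⟩ else false) = b
        cases b <;> simp [weight, hy0]
    · refine contraction_ne_zero (fun _ => hg _) hnn (fun _ => false) ?_ fun i _ => one_ne_zero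
      have : ofBits g ((List.range l).map fun _ => false) = g fun _ => false :=
        congrArg g (funext fun i => by simp)
      exact this ▸ h0

theorem listVal_onLHS {k : ℕ} (f : (Fin k → Bool) → ℝ) : (onLHS f).listVal = ofBits f := rfl

theorem listVal_onRHS {k : ℕ} (f : (Fin k → Bool) → ℝ) : (onRHS f).listVal = ofBits f := by
  funext bs
  simp [onRHS, Sig.listVal, ofBits]

theorem listVal_straddled (x y : ℝ) (bs : List Bool) :
    (straddled !![1, x; y, x * y]).listVal bs =
      weight y (bs.getD 0 false) * weight x (bs.getD 1 false) := by
  change (!![1, x; y, x * y] : Matrix _ _ ℝ) (bitIndex (bs.getD 0 false))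
    (bitIndex (bs.getD 1 false)) = _
  cases bs.getD 0 false <;> cases bs.getD 1 false <;> simp [bitIndex, weight, mul_comm]

end BipartiteHolant

theorem mainTheorem3 {r : ℕ} (a : Fin r → ℝ) {m n : ℕ}
    (f : (Fin m → Bool) → ℝ) (g : (Fin n → Bool) → ℝ) (x y : ℝ)
    (hf : ∀ α, 0 ≤ f α) (hg : ∀ β, 0 ≤ g β) (hx : 0 ≤ x) (hy : 0 ≤ y)
    (hfa : ∀ α, f α ∈ Subfield.closure (Set.range a))
    (hga : ∀ β, g β ∈ Subfield.closure (Set.range a))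
    (hxa : x ∈ Subfield.closure (Set.range a)) (hya : y ∈ Subfield.closure (Set.range a))
    (hD : BipartiteHolant.CanInterpolate a f g !![1, x; y, x * y]) :
    ((y = 0 → g (fun _ => false) = 0 → ∀ β, β ≠ (fun _ => true) → g β = 0) →
      BipartiteHolant.TuringReducible a
        (BipartiteHolant.holant ![BipartiteHolant.onLHS f, BipartiteHolant.onRHS g,
          BipartiteHolant.onRHS (BipartiteHolant.unary 1 x)])
        (BipartiteHolant.holant ![BipartiteHolant.onLHS f, BipartiteHolant.onRHS g])) ∧
    ((x = 0 → f (fun _ => false) = 0 → ∀ α, α ≠ (fun _ => true) → f α = 0) →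
      BipartiteHolant.TuringReducible a
        (BipartiteHolant.holant ![BipartiteHolant.onLHS f, BipartiteHolant.onRHS g,
          BipartiteHolant.onLHS (BipartiteHolant.unary 1 y)])
        (BipartiteHolant.holant ![BipartiteHolant.onLHS f, BipartiteHolant.onRHS g])) := by
  refine ⟨fun h => BipartiteHolant.turingReducible_of_straddled (flip := false) (f := f) (g := g)
      ?_ ?_ ?_ ?_ hg hy hfa hga hxa hya hD h,
    fun h => BipartiteHolant.turingReducible_of_straddled (flip := true) (f := g) (g := f)
      ?_ ?_ ?_ ?_ hf hx hga hfa hya hxa hD h⟩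
  · intro κ
    cases κ <;> exact ⟨rfl, rfl⟩
  · funext κ
    cases κ
    exacts [BipartiteHolant.listVal_onLHS f, BipartiteHolant.listVal_onRHS g,
      BipartiteHolant.listVal_onRHS _]
  · intro κ
    cases κ <;> exact ⟨rfl, rfl⟩
  · funext κ
    cases κ
    exacts [BipartiteHolant.listVal_onLHS f, BipartiteHolant.listVal_onRHS g,
      funext fun bs => BipartiteHolant.listVal_straddled x y bs]
  · intro κ
    cases κ <;> exact ⟨rfl, rfl⟩
  · funext κ
    cases κ
    exacts [BipartiteHolant.listVal_onRHS g, BipartiteHolant.listVal_onLHS f,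
      BipartiteHolant.listVal_onLHS _]
  · intro κ
    cases κ <;> exact ⟨rfl, rfl⟩
  · funext κ
    cases κ
    exacts [BipartiteHolant.listVal_onRHS g, BipartiteHolant.listVal_onLHS f,
      funext fun bs => (BipartiteHolant.listVal_straddled x y bs).trans (mul_comm _ _)]
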